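/- All graphs are finite and simple, and $S(x)$ denotes the unit sphere of a vertex $x$, the subgraph induced by its neighbours. A graph is contractible if it is the one-point graph, or if it has a vertex $x$ such that both $G-x$ and $S(x)$ are contractible. The empty graph is the $(-1)$-sphere; for $d\ge 0$ a graph $G$ is a $d$-sphere if every unit sphere $S(x)$ is a $(d-1)$-sphere and $G-x$ is contractible for some vertex $x$. A $d$-ball is a graph of the form $H-x$, where $H$ is a $d$-sphere and $x$ a vertex of $H$. A vertex of a $2$-ball is a boundary vertex if its unit sphere is a $1$-ball (a path with at least $3$ vertices); the boundary vertices induce a circle, and the boundary length is its number of vertices. An edge $(a,b)$ is interior if $a$ and $b$ are not both boundary vertices. The edge refinement of a graph at an edge $(a,b)$ removes this edge and adds a new vertex $c$ joined to $a$, to $b$ and to all vertices of $S(a)\cap S(b)$. A graph is Eulerian if all its vertex degrees (in a $2$-ball also those of the boundary vertices) are even. **Theorem II.** Let $G$ be a $2$-ball. There is a finite (possibly empty) sequence of edge refinements, starting from $G$ and each performed at an interior edge of the graph obtained so far, which ends in an Eulerian graph, if and only if the boundary length of $G$ is divisible by $3$. -/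

import Mathlib

universe u

namespace DiscreteSurface

/-- The unit sphere `S(x)`: the subgraph generated by the neighbours of `x`. -/
def unitSphere {V : Type u} (G : SimpleGraph V) (x : V) : SimpleGraph (G.neighborSet x) :=
  G.induce (G.neighborSet x)

/-- The graph `G - x`. -/
def removeVertex {V : Type u} (G : SimpleGraph V) (x : V) :
    SimpleGraph (({x}ᶜ : Set V) : Type u) :=
  G.induce ({x}ᶜ : Set V)

/-- A graph is contractible if it is the one-point graph, or if it has a vertex `x` such that
`G - x` and `S(x)` are both contractible. Contractible graphs are automatically finite. -/
inductive IsContractible : ∀ {V : Type u}, SimpleGraph V → Prop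
  | point {V : Type u} (G : SimpleGraph V) (hV : Nat.card V = 1) : IsContractible G
  | extend {V : Type u} (G : SimpleGraph V) (x : V)
      (hremove : IsContractible (removeVertex G x))
      (hsphere : IsContractible (unitSphere G x)) : IsContractible G

/-- `IsSphere d G`: every unit sphere of `G` is a `(d - 1)`-sphere (for `d = 0`: the empty graph)
and `G - x` is contractible for some vertex `x`. -/
def IsSphere : ℕ → ∀ {V : Type u}, SimpleGraph V → Prop
  | 0, V, G => (∀ x : V, IsEmpty (G.neighborSet x)) ∧ ∃ x : V, IsContractible (removeVertex G x)
  | d + 1, V, G =>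
      (∀ x : V, IsSphere d (unitSphere G x)) ∧ ∃ x : V, IsContractible (removeVertex G x)

/-- A `d`-ball is a graph of the form `H - x`, with `H` a `d`-sphere and `x` a vertex of `H`. -/
def IsBall (d : ℕ) {V : Type u} (G : SimpleGraph V) : Prop :=
  ∃ (W : Type u) (H : SimpleGraph W) (x : W),
    IsSphere d H ∧ Nonempty (G ≃g removeVertex H x)

/-- The boundary vertices of a discrete surface: those whose unit sphere is a `1`-ball
(a path with at least three vertices). -/
def boundary {V : Type u} (G : SimpleGraph V) : Set V :=
  {v | IsBall 1 (unitSphere G v)}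

/-- The length of the boundary circle, i.e. its number of vertices. -/
noncomputable def boundaryLength {V : Type u} (G : SimpleGraph V) : ℕ :=
  (boundary G).ncard

/-- `(a, b)` is an interior edge: an edge whose end points are not both in the boundary. -/
def IsInteriorEdge {V : Type u} (G : SimpleGraph V) (a b : V) : Prop :=
  G.Adj a b ∧ ¬ (a ∈ boundary G ∧ b ∈ boundary G)

/-- Adjacency in the edge refinement of `G` at `(a, b)`; the new vertex `c` is `none`. The edge
`(a, b)` is removed, and `c` is joined to `a`, to `b` and to all vertices in `S(a) ∩ S(b)`. -/
def refinementAdj {V : Type u} (G : SimpleGraph V) (a b : V) : Option V → Option V → Prop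
  | some x, some y => G.Adj x y ∧ ¬ (x = a ∧ y = b) ∧ ¬ (x = b ∧ y = a)
  | none, some y => y = a ∨ y = b ∨ (G.Adj a y ∧ G.Adj b y)
  | some x, none => x = a ∨ x = b ∨ (G.Adj a x ∧ G.Adj b x)
  | none, none => False

/-- The edge refinement of `G` at the edge `(a, b)`. -/
def edgeRefinement {V : Type u} (G : SimpleGraph V) (a b : V) : SimpleGraph (Option V) where
  Adj := refinementAdj G a b
  symm := by
    constructor
    intro p q h
    rcases p with _ | x <;> rcases q with _ | y <;> simp only [refinementAdj] at h ⊢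
    · exact h
    · exact h
    · exact ⟨h.1.symm, fun e => h.2.2 ⟨e.2, e.1⟩, fun e => h.2.1 ⟨e.2, e.1⟩⟩
  loopless := by
    constructor
    intro p h
    rcases p with _ | x <;> simp [refinementAdj] at h

/-- `InteriorRefinement G H`: the graph `H` is obtained from `G` by a finite (possibly empty)
sequence of edge refinements, each at an interior edge of the graph reached so far. -/
inductive InteriorRefinement {V : Type u} (G : SimpleGraph V) :
    ∀ {W : Type u}, SimpleGraph W → Prop
  | refl : InteriorRefinement G G
  | step {W : Type u} {H : SimpleGraph W} (a b : W) (hH : InteriorRefinement G H)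
      (hab : IsInteriorEdge H a b) : InteriorRefinement G (edgeRefinement H a b)

/-- A finite graph is Eulerian if all its vertex degrees are even. -/
def IsEulerian {V : Type u} (G : SimpleGraph V) : Prop :=
  ∀ v : V, Even (G.neighborSet v).ncard

end DiscreteSurface

/-!
Write the ball as `G = H - x` with a `2`-sphere `H`. A vertex of `G` is a boundary vertex exactly
if it is adjacent to `x` in `H` (`IsCapping.mem_boundary_iff`), so the boundary circle is the unit
sphere `S(x)` of `H`. An interior refinement of `G` is a refinement of `H` at an edge whose
opposite vertices differ from `x`. It keeps the properties of `H` which matter, namely that all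
unit spheres are circles (`IsSurface.refinement`) and that the first cohomology with coefficients
in `ℤ/2` vanishes (`TrivialH1.refinement`), and it does not change the boundary.

Suppose that `G` is Eulerian. Then the edges of `G` form a cycle modulo `2`. Since the first
cohomology of `H` vanishes, so does the first homology, by linear duality (`exists_vecMul_eq`), and
the cycle bounds a set of triangles of `H`. Colour these triangles black and all the others white.
An edge not containing `x` separates black from white, whereas the triangles at `x` all have the
same colour. Comparing the numbers of pairs of an edge and a triangle of either colour which
contains it shows that three times the difference of the numbers of black and white triangles is,
up to sign, twice the boundary length (`IsSurface.three_dvd_of_chain`).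

Conversely, suppose that the boundary length is divisible by `3`. Colour the boundary circle
`0, 1, 2, 0, 1, 2, …` (`IsSphere.exists_cyclic_coloring`) and the remaining vertices arbitrarily.
Monochromatic edges are interior, and one or two interior refinements get rid of such an edge
without creating others (`IsCapping.exists_isEulerian`). In the end the colouring is proper. Then
every unit sphere is properly coloured with two colours, and in the unit sphere of a boundary
vertex the two end points have different colours; so all degrees are even
(`IsCapping.isEulerian_of_coloring`).
-/

namespace DiscreteSurface

/-! ### Contractible graphs and their first cohomology -/

/-- A nonempty graph is connected if and only if every vertex property that is invariant along
edges is constant. -/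
theorem connected_iff_forall_prop {V : Type u} (G : SimpleGraph V) :
    G.Connected ↔ Nonempty V ∧ ∀ p : V → Prop, (∀ y z, G.Adj y z → p y → p z) →
      ∀ y z, p y → p z := by
  constructor
  · intro h
    refine ⟨h.nonempty, fun p hp y z hy => ?_⟩
    obtain ⟨w⟩ := h.preconnected y z
    induction w with
    | nil => exact hy
    | cons hadj _ ih => exact ih (hp _ _ hadj hy)
  · rintro ⟨hne, h⟩
    refine ⟨fun y z => ?_⟩
    exact h (fun z => G.Reachable y z) (fun _ _ hab hy => hy.trans hab.reachable) y z
      (SimpleGraph.Reachable.refl y)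

theorem connected_of_removeVertex {V : Type u} {G : SimpleGraph V} {x y : V}
    (h : (removeVertex G x).Connected) (hxy : G.Adj x y) : G.Connected := by
  rw [connected_iff_forall_prop] at h ⊢
  refine ⟨⟨x⟩, fun p hp => ?_⟩
  have key : ∀ z, p z ↔ p y := by
    intro z
    by_cases hz : z = x
    · subst hz
      exact ⟨hp _ _ hxy, hp _ _ hxy.symm⟩
    · have hy : y ≠ x := hxy.ne'
      have hp' : ∀ a b : ({x}ᶜ : Set V), (removeVertex G x).Adj a b → p a → p b :=
        fun a b hab => hp a b hab
      exact ⟨h.2 (fun v => p v) hp' ⟨z, hz⟩ ⟨y, hy⟩, h.2 (fun v => p v) hp' ⟨y, hy⟩ ⟨z, hz⟩⟩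
  intro a b ha
  exact (key b).2 ((key a).1 ha)

theorem finite_of_finite_compl_singleton {V : Type u} {x : V} (h : Finite ({x}ᶜ : Set V)) :
    Finite V := by
  have h2 : ({x} ∪ {x}ᶜ : Set V).Finite := (Set.finite_singleton x).union (Set.toFinite _)
  rw [Set.union_compl_self] at h2
  exact Set.finite_univ_iff.1 h2

theorem IsContractible.finite {V : Type u} {G : SimpleGraph V} (h : IsContractible G) :
    Finite V := by
  induction h with
  | point G hV => exact Nat.finite_of_card_ne_zero (by omega)
  | extend G x _ _ ih _ => exact finite_of_finite_compl_singleton ih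

theorem IsContractible.connected {V : Type u} {G : SimpleGraph V} (h : IsContractible G) :
    G.Connected := by
  induction h with
  | point G hV =>
    obtain ⟨h1, ⟨x⟩⟩ := Nat.card_eq_one_iff_unique.1 hV
    exact (connected_iff_forall_prop G).2 ⟨⟨x⟩, fun p _ y z hy => h1.elim y z ▸ hy⟩
  | extend G x _ _ ih ihs =>
    obtain ⟨y⟩ := ihs.nonempty
    exact connected_of_removeVertex ih y.2

/-- The first cohomology group of the clique complex of `G` with coefficients in `ℤ/2` vanishes:
a symmetric function on edges which sums to zero around every triangle is the coboundary of a
function on vertices. -/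
def TrivialH1 {V : Type u} (G : SimpleGraph V) : Prop :=
  ∀ g : V → V → ZMod 2, (∀ a b, G.Adj a b → g a b = g b a) →
    (∀ a b c, G.Adj a b → G.Adj b c → G.Adj a c → g a b + g b c = g a c) →
    ∃ h : V → ZMod 2, ∀ a b, G.Adj a b → g a b = h a + h b

/-- Coning off a connected subgraph does not create first cohomology. -/
theorem TrivialH1.of_removeVertex {V : Type u} {G : SimpleGraph V} {x : V}
    (h : TrivialH1 (removeVertex G x)) (hx : (unitSphere G x).Connected) : TrivialH1 G := by
  classical
  intro g hsymm hg
  obtain ⟨h, hh⟩ := h (fun a b => g a b) (fun a b hab => hsymm a b hab)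
    (fun a b c hab hbc hac => hg a b c hab hbc hac)
  have two : (2 : ZMod 2) = 0 := rfl
  rw [connected_iff_forall_prop] at hx
  obtain ⟨⟨y₀⟩, hconn⟩ := hx
  have hne : ∀ y : G.neighborSet x, (y : V) ∈ ({x}ᶜ : Set V) := fun y =>
    (show G.Adj x y from y.2).ne'
  have key : ∀ y : G.neighborSet x,
      h ⟨y, hne y⟩ + g y x = h ⟨y₀, hne y₀⟩ + g y₀ x := by
    intro y
    -- along an edge `yz` of the unit sphere, use the triangle `xyz`
    refine hconn (fun y => h ⟨y, hne y⟩ + g y x = h ⟨y₀, hne y₀⟩ + g y₀ x) ?_ y₀ y rfl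
    intro y z hyz hy
    have hyz' : G.Adj y z := hyz
    have h1 := hh ⟨y, hne y⟩ ⟨z, hne z⟩ hyz'
    have h2 := hg y z x hyz' z.2.symm y.2.symm
    simp only at h1 h2 ⊢
    linear_combination hy + h2 - h1 - h ⟨y, hne y⟩ * two
  refine ⟨fun v => if hv : v ∈ ({x}ᶜ : Set V) then h ⟨v, hv⟩ else h ⟨y₀, hne y₀⟩ + g y₀ x,
    fun a b hab => ?_⟩
  beta_reduce
  by_cases ha : a = x
  · subst ha
    have hb : b ∈ ({a}ᶜ : Set V) := hab.ne'
    have h1 := key ⟨b, hab⟩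
    have ha : a ∉ ({a}ᶜ : Set V) := fun h => h rfl
    rw [dif_neg ha, dif_pos hb, hsymm _ _ hab]
    simp only at h1
    linear_combination h1 - h ⟨b, hb⟩ * two
  · by_cases hb : b = x
    · subst hb
      have h1 := key ⟨a, hab.symm⟩
      have hb : b ∉ ({b}ᶜ : Set V) := fun h => h rfl
      rw [dif_pos (show a ∈ ({b}ᶜ : Set V) from ha), dif_neg hb]
      simp only at h1
      linear_combination h1 - h ⟨a, ha⟩ * two
    · rw [dif_pos (show a ∈ ({x}ᶜ : Set V) from ha), dif_pos (show b ∈ ({x}ᶜ : Set V) from hb)]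
      exact hh ⟨a, ha⟩ ⟨b, hb⟩ hab

theorem IsContractible.trivialH1 {V : Type u} {G : SimpleGraph V} (h : IsContractible G) :
    TrivialH1 G := by
  induction h with
  | point G hV =>
    obtain ⟨h1, -⟩ := Nat.card_eq_one_iff_unique.1 hV
    exact fun g _ _ => ⟨0, fun a b hab => absurd (h1.elim a b) hab.ne⟩
  | extend G x _ hs ih _ => exact ih.of_removeVertex hs.connected

/-! ### Discrete circles -/

theorem IsTree.isContractible {V : Type u} [Finite V] {G : SimpleGraph V} (h : G.IsTree) :
    IsContractible G := by
  classical
  obtain ⟨n, hn⟩ : ∃ n, Nat.card V = n := ⟨_, rfl⟩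
  induction n generalizing V with
  | zero =>
    have := h.connected.nonempty
    exact absurd hn Nat.card_pos.ne'
  | succ n ih =>
    have := Fintype.ofFinite V
    rcases subsingleton_or_nontrivial V with hs | hs
    · have := h.connected.nonempty
      exact .point G (Nat.card_eq_one_iff_unique.2 ⟨hs, this⟩)
    · obtain ⟨v, hv⟩ := h.exists_vert_degree_one_of_nontrivial
      refine .extend G v (ih ⟨h.connected.induce_compl_singleton_of_degree_eq_one hv,
        h.isAcyclic.induce _⟩ ?_) (.point _ ?_)
      · rw [Nat.card_coe_set_eq, Set.ncard_compl, hn, Set.ncard_singleton]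
        omega
      · rw [Nat.card_eq_fintype_card, SimpleGraph.card_neighborSet_eq_degree, hv]

theorem isSphere_zero_iff {V : Type u} {G : SimpleGraph V} :
    IsSphere 0 G ↔ ∃ p q, p ≠ q ∧ ¬ G.Adj p q ∧ ∀ z, z = p ∨ z = q := by
  constructor
  · rintro ⟨h0, p, hp⟩
    have hno : ∀ a b, ¬ G.Adj a b := fun a b hab => (h0 a).false ⟨b, hab⟩
    have hc := (connected_iff_forall_prop _).1 hp.connected
    obtain ⟨⟨q⟩, hc⟩ := hc
    refine ⟨p, q, fun h => q.2 h.symm, hno _ _, fun z => ?_⟩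
    by_cases hz : z = p
    · exact .inl hz
    · exact .inr (congrArg Subtype.val (hc (fun w => w = q)
        (fun y z hyz => absurd hyz (hno _ _)) q ⟨z, hz⟩ rfl))
  · rintro ⟨p, q, hne, hadj, hall⟩
    refine ⟨fun x => ⟨fun ⟨y, hy⟩ => ?_⟩, p, .point _ ?_⟩
    · have hy' : G.Adj x y := hy
      rcases hall x with rfl | rfl <;> rcases hall y with rfl | rfl
      · exact hy'.ne rfl
      · exact hadj hy'
      · exact hadj hy'.symm
      · exact hy'.ne rfl
    · refine Nat.card_eq_one_iff_unique.2 ⟨⟨fun a b => ?_⟩, ⟨q, fun h => hne (h : q = p).symm⟩⟩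
      exact Subtype.ext (((hall a).resolve_left a.2).trans ((hall b).resolve_left b.2).symm)

/-- The discrete circles are the finite connected graphs in which every vertex has exactly two
neighbours, and these are not adjacent. -/
theorem isSphere_one_iff {V : Type u} {G : SimpleGraph V} :
    IsSphere 1 G ↔ Finite V ∧ G.Connected ∧
      ∀ v, ∃ p q, p ≠ q ∧ ¬ G.Adj p q ∧ ∀ z, G.Adj v z ↔ z = p ∨ z = q := by
  have key : ∀ v, IsSphere 0 (unitSphere G v) ↔
      ∃ p q, p ≠ q ∧ ¬ G.Adj p q ∧ ∀ z, G.Adj v z ↔ z = p ∨ z = q := by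
    intro v
    rw [isSphere_zero_iff]
    constructor
    · rintro ⟨p, q, hne, hadj, hall⟩
      refine ⟨p, q, fun h => hne (Subtype.ext h), hadj, fun z => ⟨fun hz => ?_, ?_⟩⟩
      · exact (hall ⟨z, hz⟩).imp (congrArg Subtype.val) (congrArg Subtype.val)
      · rintro (rfl | rfl)
        exacts [p.2, q.2]
    · rintro ⟨p, q, hne, hadj, hall⟩
      refine ⟨⟨p, (hall p).2 (.inl rfl)⟩, ⟨q, (hall q).2 (.inr rfl)⟩,
        fun h => hne (congrArg Subtype.val h), hadj, fun z => ?_⟩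
      exact ((hall z).1 z.2).imp (fun h => Subtype.ext h) (fun h => Subtype.ext h)
  constructor
  · rintro ⟨h, y, hy⟩
    obtain ⟨p, q, -, -, hp⟩ := (key y).1 (h y)
    exact ⟨finite_of_finite_compl_singleton hy.finite,
      connected_of_removeVertex hy.connected ((hp p).2 (.inl rfl)), fun v => (key v).1 (h v)⟩
  · rintro ⟨hfin, hconn, h⟩
    refine ⟨fun v => (key v).2 (h v), ?_⟩
    classical
    have := Fintype.ofFinite V
    have hdeg : ∀ v, G.degree v = 2 := by
      intro v
      obtain ⟨p, q, hne, -, hall⟩ := h v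
      have : G.neighborFinset v = {p, q} := by ext z; simp [hall]
      rw [← SimpleGraph.card_neighborFinset_eq_degree, this, Finset.card_pair hne]
    have hnt : Nontrivial V := by
      obtain ⟨v⟩ := hconn.nonempty
      obtain ⟨p, q, hne, -⟩ := h v
      exact ⟨p, q, hne⟩
    -- A vertex whose removal keeps the circle connected; the rest is a tree by counting edges.
    obtain ⟨y, hy⟩ := hconn.exists_connected_induce_compl_singleton_of_finite_nontrivial
    refine ⟨y, IsTree.isContractible (SimpleGraph.isTree_iff_connected_and_card.2 ⟨hy, ?_⟩)⟩
    have h1 := G.sum_degrees_eq_twice_card_edges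
    simp only [hdeg, Finset.sum_const, Finset.card_univ, smul_eq_mul] at h1
    have h2 := G.card_edgeFinset_induce_compl_singleton y
    rw [G.card_edgeFinset_deleteIncidenceSet, hdeg] at h2
    have h3 : Nat.card (({y}ᶜ : Set V) : Type u) = Fintype.card V - 1 := by
      rw [Nat.card_coe_set_eq, Set.ncard_compl, Set.ncard_singleton, Nat.card_eq_fintype_card]
    have h4 : Nat.card (removeVertex G y).edgeSet = (G.induce {y}ᶜ).edgeFinset.card := by
      rw [SimpleGraph.edgeFinset_card, ← Nat.card_eq_fintype_card]
      rfl
    rw [h3, h4, h2]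
    have := Fintype.one_lt_card (α := V)
    omega

/-! ### Closed surfaces and the cohomology of a refinement -/

/-- Connectedness of a unit sphere in terms of vertices of the whole graph. -/
theorem unitSphere_connected_iff {V : Type u} (G : SimpleGraph V) (v : V) :
    (unitSphere G v).Connected ↔ (∃ y, G.Adj v y) ∧ ∀ p : V → Prop,
      (∀ y z, G.Adj v y → G.Adj v z → G.Adj y z → p y → p z) →
      ∀ y z, G.Adj v y → G.Adj v z → p y → p z := by
  classical
  rw [connected_iff_forall_prop]
  constructor
  · rintro ⟨⟨y⟩, h⟩
    refine ⟨⟨y, y.2⟩, fun p hp y z hy hz => ?_⟩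
    exact h (fun w => p w) (fun a b hab => hp a b a.2 b.2 hab) ⟨y, hy⟩ ⟨z, hz⟩
  · rintro ⟨⟨y, hy⟩, h⟩
    refine ⟨⟨⟨y, hy⟩⟩, fun p hp y z hpy => ?_⟩
    exact (h (fun w => ∃ hw : G.Adj v w, p ⟨w, hw⟩)
      (fun a b ha hb hab hpa => ⟨hb, hp ⟨a, ha⟩ ⟨b, hb⟩ hab hpa.2⟩) y z y.2 z.2
        ⟨y.2, hpy⟩).2

/-- A closed discrete surface: a finite graph all of whose unit spheres are circles. The second
field says that the neighbours of a vertex inside any unit sphere are two non-adjacent vertices,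
phrased as a condition on the common neighbours of the two ends of an edge. -/
structure IsSurface {V : Type u} (H : SimpleGraph V) : Prop where
  finite : Finite V
  common : ∀ v w, H.Adj v w → ∃ p q, p ≠ q ∧ ¬ H.Adj p q ∧
    ∀ z, (H.Adj v z ∧ H.Adj w z) ↔ z = p ∨ z = q
  connected : ∀ v, (unitSphere H v).Connected

theorem unitSphere_common {V : Type u} {H : SimpleGraph V} {v w : V} (hw : H.Adj v w)
    (h : ∃ p q, p ≠ q ∧ ¬ H.Adj p q ∧ ∀ z, (H.Adj v z ∧ H.Adj w z) ↔ z = p ∨ z = q) :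
    ∃ p q, p ≠ q ∧ ¬ (unitSphere H v).Adj p q ∧
      ∀ z, (unitSphere H v).Adj ⟨w, hw⟩ z ↔ z = p ∨ z = q := by
  obtain ⟨p, q, hne, hadj, hall⟩ := h
  refine ⟨⟨p, ((hall p).2 (.inl rfl)).1⟩, ⟨q, ((hall q).2 (.inr rfl)).1⟩,
    fun h => hne (congrArg Subtype.val h), hadj, fun z => ⟨fun hz => ?_, ?_⟩⟩
  · exact ((hall z).1 ⟨z.2, hz⟩).imp (fun h => Subtype.ext h) (fun h => Subtype.ext h)
  · rintro (rfl | rfl)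
    exacts [((hall p).2 (.inl rfl)).2, ((hall q).2 (.inr rfl)).2]

theorem IsSurface.isSphere_unitSphere {V : Type u} {H : SimpleGraph V} (h : IsSurface H) (v : V) :
    IsSphere 1 (unitSphere H v) := by
  have := h.finite
  exact isSphere_one_iff.2 ⟨inferInstance, h.connected v,
    fun w => unitSphere_common w.2 (h.common v w w.2)⟩

theorem IsSphere.isSurface {V : Type u} {H : SimpleGraph V} (h : IsSphere 2 H) : IsSurface H := by
  obtain ⟨hs, y, hy⟩ := h
  refine ⟨finite_of_finite_compl_singleton hy.finite, fun v w hvw => ?_,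
    fun v => (isSphere_one_iff.1 (hs v)).2.1⟩
  obtain ⟨p, q, hne, hadj, hall⟩ := (isSphere_one_iff.1 (hs v)).2.2 ⟨w, hvw⟩
  refine ⟨p, q, fun h => hne (Subtype.ext h), hadj, fun z => ⟨fun hz => ?_, ?_⟩⟩
  · exact ((hall ⟨z, hz.1⟩).1 hz.2).imp (congrArg Subtype.val) (congrArg Subtype.val)
  · rintro (rfl | rfl)
    exacts [⟨p.2, (hall p).2 (.inl rfl)⟩, ⟨q.2, (hall q).2 (.inr rfl)⟩]

theorem IsSphere.trivialH1 {V : Type u} {H : SimpleGraph V} (h : IsSphere 2 H) : TrivialH1 H := by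
  obtain ⟨hs, y, hy⟩ := h
  exact hy.trivialH1.of_removeVertex (isSphere_one_iff.1 (hs y)).2.1

section refinement

variable {V : Type u} {G : SimpleGraph V} {a b : V}

@[simp]
theorem edgeRefinement_adj_some_some {x y : V} : (edgeRefinement G a b).Adj (some x) (some y) ↔
    G.Adj x y ∧ ¬ (x = a ∧ y = b) ∧ ¬ (x = b ∧ y = a) := Iff.rfl

@[simp]
theorem edgeRefinement_adj_none_some {y : V} : (edgeRefinement G a b).Adj none (some y) ↔
    y = a ∨ y = b ∨ (G.Adj a y ∧ G.Adj b y) := Iff.rfl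

@[simp]
theorem edgeRefinement_adj_some_none {x : V} : (edgeRefinement G a b).Adj (some x) none ↔
    x = a ∨ x = b ∨ (G.Adj a x ∧ G.Adj b x) := Iff.rfl

theorem edgeRefinement_comm : edgeRefinement G a b = edgeRefinement G b a := by
  ext x y
  cases x <;> cases y <;> simp <;> tauto

/-- A cocycle on the refinement induces one on the original graph, with value
`g(a, c) + g(c, b)` on the refined edge. -/
theorem TrivialH1.refinement (h : TrivialH1 G) (hab : G.Adj a b) :
    TrivialH1 (edgeRefinement G a b) := by
  classical
  intro g hsymm hg
  have two : (2 : ZMod 2) = 0 := rfl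
  let k : V → V → ZMod 2 := fun x y =>
    if (x = a ∧ y = b) ∨ (x = b ∧ y = a) then g (some a) none + g none (some b)
    else g (some x) (some y)
  have hkab : k a b = g (some a) none + g none (some b) := if_pos (.inl ⟨rfl, rfl⟩)
  have hkba : k b a = g (some a) none + g none (some b) := if_pos (.inr ⟨rfl, rfl⟩)
  have hk : ∀ x y, ¬ (x = a ∧ y = b) → ¬ (x = b ∧ y = a) → k x y = g (some x) (some y) :=
    fun x y h1 h2 => if_neg (by tauto)
  have hksymm : ∀ x y, G.Adj x y → k x y = k y x := by
    intro x y hxy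
    by_cases h1 : x = a ∧ y = b
    · rw [h1.1, h1.2, hkab, hkba]
    by_cases h2 : x = b ∧ y = a
    · rw [h2.1, h2.2, hkab, hkba]
    rw [hk x y h1 h2, hk y x (fun h => h2 ⟨h.2, h.1⟩) (fun h => h1 ⟨h.2, h.1⟩)]
    exact hsymm _ _ ⟨hxy, h1, h2⟩
  -- the two triangles at the refined edge
  have tri : ∀ z, G.Adj a z → G.Adj b z → k a b = k a z + k b z := by
    intro z haz hbz
    have e1 := hg (some a) none (some z) (.inl rfl) (.inr (.inr ⟨haz, hbz⟩))
      ⟨haz, fun h => hbz.ne h.2.symm, fun h => hab.ne h.1⟩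
    have e2 := hg (some b) none (some z) (.inr (.inl rfl)) (.inr (.inr ⟨haz, hbz⟩))
      ⟨hbz, fun h => hab.ne h.1.symm, fun h => haz.ne h.2.symm⟩
    have e3 := hsymm none (some b) (.inr (.inl rfl))
    rw [hkab, hk a z (fun h => hbz.ne h.2.symm) (fun h => hab.ne h.1),
      hk b z (fun h => hab.ne h.1.symm) (fun h => haz.ne h.2.symm)]
    linear_combination e1 + e2 + e3 - two * g none (some z)
  have hkc : ∀ x y z, G.Adj x y → G.Adj y z → G.Adj x z → k x y + k y z = k x z := by
    intro x y z hxy hyz hxz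
    by_cases h1 : x = a ∧ y = b
    · obtain ⟨rfl, rfl⟩ := h1
      linear_combination tri z hxz hyz + two * k y z
    by_cases h2 : x = b ∧ y = a
    · obtain ⟨rfl, rfl⟩ := h2
      linear_combination hksymm _ _ hxy + tri z hyz hxz + two * k y z
    by_cases h3 : y = a ∧ z = b
    · obtain ⟨rfl, rfl⟩ := h3
      linear_combination tri x hxy.symm hxz.symm + hksymm _ _ hxy + two * k y x
        + hksymm _ _ hxz.symm
    by_cases h4 : y = b ∧ z = a
    · obtain ⟨rfl, rfl⟩ := h4
      linear_combination tri x hxz.symm hxy.symm + hksymm _ _ hxy + two * k y x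
        + hksymm _ _ hxz.symm + hksymm _ _ hyz
    by_cases h5 : x = a ∧ z = b
    · obtain ⟨rfl, rfl⟩ := h5
      linear_combination - tri y hxy hyz.symm + hksymm _ _ hyz
    by_cases h6 : x = b ∧ z = a
    · obtain ⟨rfl, rfl⟩ := h6
      linear_combination - tri y hyz.symm hxy + hksymm _ _ hyz + hksymm _ _ hxz.symm
    rw [hk x y h1 h2, hk y z h3 h4, hk x z h5 h6]
    exact hg _ _ _ ⟨hxy, h1, h2⟩ ⟨hyz, h3, h4⟩ ⟨hxz, h5, h6⟩
  obtain ⟨h, hh⟩ := h k hksymm hkc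
  -- the value at the new vertex
  let m : ZMod 2 := h a + g (some a) none
  have hold : ∀ y, (G.Adj a y ∧ G.Adj b y) → g (some y) none = h y + m := by
    intro z hz
    have e1 := hg (some a) none (some z) (.inl rfl) (.inr (.inr hz))
      ⟨hz.1, fun h => hz.2.ne h.2.symm, fun h => hab.ne h.1⟩
    have e2 := hh a z hz.1
    rw [hk a z (fun h => hz.2.ne h.2.symm) (fun h => hab.ne h.1)] at e2
    have e3 := hsymm (some z) none (.inr (.inr hz))
    simp only [m]
    linear_combination e3 + e1 + e2 - two * g (some a) none
  have hnone : ∀ y, (edgeRefinement G a b).Adj (some y) none → g (some y) none = h y + m := by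
    rintro y (rfl | rfl | hy)
    · simp only [m]
      linear_combination - two * h y
    · have e1 := hh a y hab
      have e2 := hsymm (some y) none (.inr (.inl rfl))
      rw [hkab] at e1
      simp only [m]
      linear_combination e2 + e1 - two * g (some a) none
    · exact hold y hy
  refine ⟨fun v => v.elim m h, ?_⟩
  rintro (_ | x) (_ | y) hxy
  · exact hxy.elim
  · rw [hsymm _ _ hxy, hnone y hxy.symm]
    exact add_comm _ _
  · exact hnone x hxy
  · have := hh x y hxy.1
    rwa [hk x y hxy.2.1 hxy.2.2] at this

end refinement

/-! ### Refinements of closed surfaces -/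

section

variable {V : Type u} {H : SimpleGraph V} {a b : V}

theorem IsSurface.common_refinement (h : IsSurface H) (hab : H.Adj a b) (v w : Option V)
    (hvw : (edgeRefinement H a b).Adj v w) :
    ∃ p q, p ≠ q ∧ ¬ (edgeRefinement H a b).Adj p q ∧
    ∀ z, ((edgeRefinement H a b).Adj v z ∧ (edgeRefinement H a b).Adj w z) ↔ z = p ∨ z = q := by
  obtain ⟨c, d, hcd, hncd, hc⟩ := h.common a b hab
  have hca := (hc c).2 (.inl rfl)
  have hda := (hc d).2 (.inr rfl)
  have hsym := H.symm
  -- an edge at an end of the refined edge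
  have end_case : ∀ a b w : V, H.Adj a b → (∀ z, (H.Adj a z ∧ H.Adj b z) ↔ z = c ∨ z = d) →
      H.Adj a w → w ≠ b → ∃ p q, p ≠ q ∧ ¬ (edgeRefinement H a b).Adj p q ∧
      ∀ z, ((edgeRefinement H a b).Adj (some a) z ∧ (edgeRefinement H a b).Adj (some w) z) ↔
        z = p ∨ z = q := by
    intro a b w hab hc haw hwb
    have hca := (hc c).2 (.inl rfl)
    have hda := (hc d).2 (.inr rfl)
    obtain ⟨p, q, hpq, hnpq, hp⟩ := h.common a w haw
    by_cases hw : H.Adj b w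
    · -- one of the two common neighbours of `a` and `w` is `b`; the new vertex takes its place
      have hw' := (hc w).1 ⟨haw, hw⟩
      obtain ⟨r, hr, hr'⟩ : ∃ r, r ≠ b ∧ ∀ z, (H.Adj a z ∧ H.Adj w z) ↔ z = b ∨ z = r := by
        rcases (hp b).1 ⟨hab, hw.symm⟩ with rfl | rfl
        · exact ⟨q, hpq.symm, hp⟩
        · exact ⟨p, hpq, fun z => (hp z).trans or_comm⟩
      have hrr := (hr' r).2 (.inr rfl)
      have hnr : ¬ (H.Adj a r ∧ H.Adj b r) := by
        intro hh
        rcases (hc r).1 hh with rfl | rfl <;> rcases hw' with rfl | rfl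
        · exact hrr.2.ne rfl
        · exact hncd hrr.2.symm
        · exact hncd hrr.2
        · exact hrr.2.ne rfl
      refine ⟨none, some r, by simp, ?_, ?_⟩
      · rintro (e | e | e)
        exacts [hrr.1.ne e.symm, hr e, hnr e]
      · rintro (_ | z)
        · simp [haw, hw]
        · have h1 := hr' z
          have h2 := haw.ne'
          have h3 := hab.ne
          simp only [edgeRefinement_adj_some_some, reduceCtorEq, false_or, Option.some.injEq]
          constructor
          · rintro ⟨⟨h4, h5, -⟩, h6, -⟩
            exact (h1.1 ⟨h4, h6⟩).resolve_left fun e => h5 ⟨trivial, e⟩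
          · rintro rfl
            exact ⟨⟨hrr.1, fun e => hr e.2, fun e => h3 e.1⟩, hrr.2, fun e => h2 e.1,
              fun e => hwb e.1⟩
    · refine ⟨some p, some q, by simpa using hpq, fun h => hnpq h.1, ?_⟩
      rintro (_ | z)
      · simp [hw, haw.ne', hwb]
      · have h1 := hp z
        have h2 := haw.ne'
        have h3 := hab.ne
        simp only [edgeRefinement_adj_some_some, Option.some.injEq]
        rw [← h1]
        constructor
        · rintro ⟨⟨h4, -⟩, h6, -⟩
          exact ⟨h4, h6⟩
        · rintro ⟨h4, h5⟩
          exact ⟨⟨h4, fun e => hw (e.2 ▸ h5.symm), fun e => h3 e.1⟩, h5, fun e => h2 e.1,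
            fun e => hwb e.1⟩
  -- the same for both ends, in both directions
  have end_case' : ∀ x w : V, x = a ∨ x = b → (edgeRefinement H a b).Adj (some x) (some w) →
      ∃ p q, p ≠ q ∧ ¬ (edgeRefinement H a b).Adj p q ∧
      ∀ z, ((edgeRefinement H a b).Adj (some x) z ∧ (edgeRefinement H a b).Adj (some w) z) ↔
        z = p ∨ z = q := by
    rintro x w (rfl | rfl) ⟨hxw, h1, h2⟩
    · exact end_case x b w hab hc hxw fun e => h1 ⟨rfl, e⟩
    · rw [edgeRefinement_comm]
      exact end_case x a w hab.symm (fun z => and_comm.trans (hc z)) hxw fun e => h2 ⟨rfl, e⟩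
  have none_case : ∀ x : V, (edgeRefinement H a b).Adj none (some x) →
      ∃ p q, p ≠ q ∧ ¬ (edgeRefinement H a b).Adj p q ∧
      ∀ z, ((edgeRefinement H a b).Adj none z ∧ (edgeRefinement H a b).Adj (some x) z) ↔
        z = p ∨ z = q := by
    intro x hx
    have hne := hab.ne
    have hba := hab.symm
    have hmid : ¬ (x = a ∨ x = b) → (x = c ∨ x = d) := fun hn =>
      (hc x).1 ((hx.imp_right (Or.resolve_left · fun e => hn (.inr e))).resolve_left
        fun e => hn (.inl e))
    by_cases hxab : x = a ∨ x = b
    · refine ⟨some c, some d, by simpa using hcd, fun h => hncd h.1, ?_⟩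
      rintro (_ | z)
      · simp
      · have h1 := hc z
        rcases hxab with rfl | rfl <;> simp only [edgeRefinement_adj_none_some,
          edgeRefinement_adj_some_some, Option.some.injEq, ← h1] <;> grind [SimpleGraph.irrefl]
    · refine ⟨some a, some b, by simpa using hne, by simp, ?_⟩
      rintro (_ | z)
      · simp
      · have h1 := hc z
        have h2 := hc x
        rcases hmid hxab with rfl | rfl <;> simp only [edgeRefinement_adj_none_some,
          edgeRefinement_adj_some_some, Option.some.injEq] <;>
          grind [SimpleGraph.irrefl, SimpleGraph.adj_comm]
  have swap : ∀ v w : Option V, (∃ p q, p ≠ q ∧ ¬ (edgeRefinement H a b).Adj p q ∧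
      ∀ z, ((edgeRefinement H a b).Adj v z ∧ (edgeRefinement H a b).Adj w z) ↔ z = p ∨ z = q) →
      ∃ p q, p ≠ q ∧ ¬ (edgeRefinement H a b).Adj p q ∧
      ∀ z, ((edgeRefinement H a b).Adj w z ∧ (edgeRefinement H a b).Adj v z) ↔ z = p ∨ z = q := by
    rintro v w ⟨p, q, h1, h2, h3⟩
    exact ⟨p, q, h1, h2, fun z => and_comm.trans (h3 z)⟩
  rcases v with _ | v <;> rcases w with _ | w
  · exact hvw.elim
  · exact none_case w hvw
  · exact swap _ _ (none_case v hvw.symm)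
  · by_cases hv : v = a ∨ v = b
    · exact end_case' v w hv hvw
    by_cases hw : w = a ∨ w = b
    · exact swap _ _ (end_case' w v hw hvw.symm)
    obtain ⟨p, q, hpq, hnpq, hp⟩ := h.common v w hvw.1
    refine ⟨some p, some q, by simpa using hpq, fun h => hnpq h.1, ?_⟩
    have hno : ¬ ((H.Adj a v ∧ H.Adj b v) ∧ (H.Adj a w ∧ H.Adj b w)) := by
      rw [hc, hc]
      rintro ⟨rfl | rfl, rfl | rfl⟩
      · exact hvw.1.ne rfl
      · exact hncd hvw.1
      · exact hncd hvw.1.symm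
      · exact hvw.1.ne rfl
    rintro (_ | z)
    · simp only [edgeRefinement_adj_some_none, reduceCtorEq, or_self, iff_false]
      tauto
    · have h1 := hp z
      simp only [edgeRefinement_adj_some_some, Option.some.injEq, ← h1]
      tauto

/-- The unit sphere of the new vertex is a circle of length four, in the unit spheres of the two
ends of the refined edge the new vertex replaces the other end, and in those of the two opposite
vertices the refined edge is subdivided. -/
theorem IsSurface.connected_refinement (h : IsSurface H) (hab : H.Adj a b) (v : Option V) :
    (unitSphere (edgeRefinement H a b) v).Connected := by
  obtain ⟨c, d, hcd, hncd, hc⟩ := h.common a b hab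
  have hca := (hc c).2 (.inl rfl)
  have hend : ∀ a b : V, H.Adj a b →
      (unitSphere (edgeRefinement H a b) (some a)).Connected := by
    intro a b hab
    rw [unitSphere_connected_iff]
    have hcon := ((unitSphere_connected_iff H a).1 (h.connected a)).2
    refine ⟨⟨none, .inl rfl⟩, fun p hp => ?_⟩
    -- the new vertex takes the place of `b`
    have key := hcon (fun y => (y = b → p none) ∧ (y ≠ b → p (some y))) (by
      intro y z hy hz hyz ⟨h1, h2⟩
      constructor
      · rintro rfl
        exact hp (some y) none ⟨hy, fun h => hyz.ne h.2, fun h => hab.ne h.1⟩ (.inl rfl)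
          (.inr (.inr ⟨hy, hyz.symm⟩)) (h2 hyz.ne)
      · intro hzb
        have hz' : (edgeRefinement H a b).Adj (some a) (some z) :=
          ⟨hz, fun h => hzb h.2, fun h => hab.ne h.1⟩
        by_cases hyb : y = b
        · subst hyb
          exact hp none (some z) (.inl rfl) hz' (.inr (.inr ⟨hz, hyz⟩)) (h1 rfl)
        · exact hp (some y) (some z) ⟨hy, fun h => hyb h.2, fun h => hab.ne h.1⟩ hz'
            ⟨hyz, fun h => hzb h.2, fun h => hyb h.1⟩ (h2 hyb))
    rintro (_ | y) (_ | z) hy hz hpy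
    · exact hpy
    · have hzb : z ≠ b := fun e => hz.2.1 ⟨rfl, e⟩
      exact (key b z hab hz.1 ⟨fun _ => hpy, fun e => absurd rfl e⟩).2 hzb
    · have hyb : y ≠ b := fun e => hy.2.1 ⟨rfl, e⟩
      exact (key y b hy.1 hab ⟨fun e => absurd e hyb, fun _ => hpy⟩).1 rfl
    · have hzb : z ≠ b := fun e => hz.2.1 ⟨rfl, e⟩
      have hyb : y ≠ b := fun e => hy.2.1 ⟨rfl, e⟩
      exact (key y z hy.1 hz.1 ⟨fun e => absurd e hyb, fun _ => hpy⟩).2 hzb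
  rcases v with _ | v
  · rw [unitSphere_connected_iff]
    refine ⟨⟨some a, .inl rfl⟩, fun p hp => ?_⟩
    have key : ∀ x y : V, (edgeRefinement H a b).Adj none (some x) →
        (edgeRefinement H a b).Adj none (some y) → (edgeRefinement H a b).Adj (some x) (some y) →
        (p (some x) ↔ p (some y)) :=
      fun x y hx hy hxy => ⟨hp _ _ hx hy hxy, hp _ _ hy hx hxy.symm⟩
    have hA : ∀ y, H.Adj a y ∧ H.Adj b y → (p (some a) ↔ p (some y)) := fun y hy =>
      key a y (.inl rfl) (.inr (.inr hy)) ⟨hy.1, fun h => hy.2.ne h.2.symm, fun h => hab.ne h.1⟩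
    have hB : ∀ y, H.Adj a y ∧ H.Adj b y → (p (some b) ↔ p (some y)) := fun y hy =>
      key b y (.inr (.inl rfl)) (.inr (.inr hy))
        ⟨hy.2, fun h => hab.ne h.1.symm, fun h => hy.1.ne h.2.symm⟩
    have hall : ∀ y, (edgeRefinement H a b).Adj none y → (p (some a) ↔ p y) := by
      rintro (_ | y) (rfl | rfl | hy)
      · exact Iff.rfl
      · exact (hA c hca).trans (hB c hca).symm
      · exact hA y hy
    exact fun y z hy hz hpy => (hall z hz).1 ((hall y hy).2 hpy)
  · by_cases hva : v = a
    · exact hva ▸ hend a b hab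
    by_cases hvb : v = b
    · rw [edgeRefinement_comm, hvb]
      exact hend b a hab.symm
    rw [unitSphere_connected_iff]
    obtain ⟨⟨y₀, hy₀⟩, hcon⟩ := (unitSphere_connected_iff H v).1 (h.connected v)
    have hadj : ∀ y, H.Adj v y → (edgeRefinement H a b).Adj (some v) (some y) := fun y hy =>
      ⟨hy, fun h => hva h.1, fun h => hvb h.1⟩
    refine ⟨⟨some y₀, hadj _ hy₀⟩, fun p hp => ?_⟩
    have hcase : (edgeRefinement H a b).Adj (some v) none → H.Adj a v ∧ H.Adj b v := fun h =>
      (h.resolve_left hva).resolve_left hvb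
    have key := hcon (fun y => p (some y)) (by
      intro y z hy hz hyz hpy
      have hmid : H.Adj a v → H.Adj b v → (edgeRefinement H a b).Adj (some v) none :=
        fun h1 h2 => .inr (.inr ⟨h1, h2⟩)
      by_cases h1 : y = a ∧ z = b
      · obtain ⟨rfl, rfl⟩ := h1
        have hm := hmid hy.symm hz.symm
        exact hp none _ hm (hadj _ hz) (.inr (.inl rfl)) (hp _ none (hadj _ hy) hm (.inl rfl) hpy)
      by_cases h2 : y = b ∧ z = a
      · obtain ⟨rfl, rfl⟩ := h2
        have hm := hmid hz.symm hy.symm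
        exact hp none _ hm (hadj _ hz) (.inl rfl) (hp _ none (hadj _ hy) hm (.inr (.inl rfl)) hpy)
      exact hp _ _ (hadj _ hy) (hadj _ hz) ⟨hyz, h1, h2⟩ hpy)
    rintro (_ | y) (_ | z) hy hz hpy
    · exact hpy
    · obtain ⟨h1, h2⟩ := hcase hy
      exact key a z h1.symm hz.1 (hp none (some a) hy (hadj a h1.symm) (.inl rfl) hpy)
    · obtain ⟨h1, h2⟩ := hcase hz
      exact hp (some a) none (hadj a h1.symm) hz (.inl rfl) (key y a hy.1 h1.symm hpy)
    · exact key y z hy.1 hz.1 hpy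

theorem IsSurface.refinement (h : IsSurface H) (hab : H.Adj a b) :
    IsSurface (edgeRefinement H a b) where
  finite := by have := h.finite; infer_instance
  common := h.common_refinement hab
  connected := h.connected_refinement hab

end

/-! ### Balls as closed surfaces with a vertex removed -/

section

variable {V W : Type u} {G : SimpleGraph V} {H : SimpleGraph W} {ι : G ↪g H} {x : W}

/-- The embedding `ι` presents `G` as `H - x`, where `H` is a closed surface with vanishing first
cohomology; so `H` arises from `G` by coning off the boundary with `x`. -/
structure IsCapping (ι : G ↪g H) (x : W) : Prop where
  surface : IsSurface H
  trivialH1 : TrivialH1 H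
  range : Set.range ι = {x}ᶜ

theorem IsBall.exists_isCapping (h : IsBall 2 G) :
    ∃ (W : Type u) (H : SimpleGraph W) (x : W) (ι : G ↪g H), IsCapping ι x := by
  obtain ⟨W, H, x, hH, ⟨e⟩⟩ := h
  refine ⟨W, H, x, (SimpleGraph.Embedding.induce _).comp e.toEmbedding, hH.isSurface,
    hH.trivialH1, ?_⟩
  ext y
  constructor
  · rintro ⟨v, rfl⟩
    exact (e v).2
  · intro hy
    exact ⟨e.symm ⟨y, hy⟩, congrArg Subtype.val (e.apply_symm_apply _)⟩

theorem IsCapping.ne (h : IsCapping ι x) (v : V) : ι v ≠ x := by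
  have : ι v ∈ ({x}ᶜ : Set W) := h.range ▸ Set.mem_range_self v
  exact this

theorem IsCapping.exists_eq (h : IsCapping ι x) {y : W} (hy : y ≠ x) : ∃ v, ι v = y := by
  have : y ∈ Set.range ι := h.range ▸ hy
  exact this

theorem IsCapping.mem_boundary_iff (h : IsCapping ι x) {v : V} :
    v ∈ boundary G ↔ H.Adj x (ι v) := by
  constructor
  · rintro ⟨W', S, y, hS, ⟨e⟩⟩
    by_contra hx
    obtain ⟨-, -, hS⟩ := isSphere_one_iff.1 hS
    -- a neighbour of `y` is an end point of the path `S - y`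
    obtain ⟨p, q, -, hpq, hy⟩ := hS y
    have hyp : S.Adj y p := (hy p).2 (.inl rfl)
    obtain ⟨r, hr⟩ : ∃ r, ∀ z, S.Adj p z → z = y ∨ z = r := by
      obtain ⟨r, s, -, -, hp⟩ := hS p
      rcases (hp y).1 hyp.symm with rfl | rfl
      · exact ⟨s, fun z hz => (hp z).1 hz⟩
      · exact ⟨r, fun z hz => ((hp z).1 hz).symm⟩
    let u := e.symm ⟨p, hyp.ne'⟩
    obtain ⟨c, d, hcd, -, hc⟩ := h.surface.common (ι v) (ι u) (ι.map_adj_iff.2 u.2)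
    have key : ∀ z, H.Adj (ι v) z ∧ H.Adj (ι u) z →
        ∃ t : G.neighborSet v, ι t = z ∧ (e t : W') = r := by
      rintro z ⟨hz1, hz2⟩
      obtain ⟨t, rfl⟩ := h.exists_eq (y := z) (by rintro rfl; exact hx hz1.symm)
      refine ⟨⟨t, ι.map_adj_iff.1 hz1⟩, rfl, ?_⟩
      have h1 : (unitSphere G v).Adj u ⟨t, ι.map_adj_iff.1 hz1⟩ := ι.map_adj_iff.1 hz2
      have h2 := e.map_adj_iff.2 h1
      rw [e.apply_symm_apply] at h2
      exact (hr _ h2).resolve_left (e _).2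
    obtain ⟨t, rfl, ht⟩ := key c ((hc c).2 (.inl rfl))
    obtain ⟨t', rfl, ht'⟩ := key d ((hc d).2 (.inr rfl))
    exact hcd (congrArg (fun w : G.neighborSet v => ι w)
      (e.injective (Subtype.ext (ht.trans ht'.symm))))
  · intro hx
    refine ⟨H.neighborSet (ι v), unitSphere H (ι v), ⟨x, hx.symm⟩,
      h.surface.isSphere_unitSphere _, ⟨⟨Equiv.ofBijective (fun z => ⟨⟨ι z,
        ι.map_adj_iff.2 z.2⟩, fun hz => h.ne z (congrArg Subtype.val hz)⟩) ⟨?_, ?_⟩, ?_⟩⟩⟩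
    · intro z z' hz
      exact Subtype.ext (ι.injective (congrArg (fun w => w.1.1) hz))
    · rintro ⟨⟨z, hz⟩, hzx⟩
      obtain ⟨t, rfl⟩ := h.exists_eq (y := z) fun e => hzx (Subtype.ext e)
      exact ⟨⟨t, ι.map_adj_iff.1 hz⟩, rfl⟩
    · intro z z'
      exact ι.map_adj_iff

/-- The embedding of edge refinements induced by an embedding of graphs as an induced
subgraph. -/
def refinementEmbedding (ι : G ↪g H) (a b : V) :
    edgeRefinement G a b ↪g edgeRefinement H (ι a) (ι b) where
  toFun := Option.map ι
  inj' := Option.map_injective ι.injective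
  map_rel_iff' := by
    rintro (_ | y) (_ | z) <;> simp [ι.injective.eq_iff]

theorem IsCapping.refinement (h : IsCapping ι x) {a b : V} (hab : IsInteriorEdge G a b) :
    IsCapping (refinementEmbedding ι a b) (some x) where
  surface := h.surface.refinement (ι.map_adj_iff.2 hab.1)
  trivialH1 := h.trivialH1.refinement (ι.map_adj_iff.2 hab.1)
  range := by
    ext y
    constructor
    · rintro ⟨v | v, rfl⟩
      · simp [refinementEmbedding]
      · simpa [refinementEmbedding] using h.ne v
    · intro hy
      rcases y with _ | y
      · exact ⟨none, rfl⟩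
      · obtain ⟨v, rfl⟩ := h.exists_eq (y := y) fun e => hy (congrArg some e)
        exact ⟨some v, rfl⟩

theorem IsCapping.boundary_refinement (h : IsCapping ι x) {a b : V}
    (hab : IsInteriorEdge G a b) :
    boundary (edgeRefinement G a b) = some '' boundary G := by
  have hint : ¬ (H.Adj x (ι a) ∧ H.Adj x (ι b)) := by
    rw [← h.mem_boundary_iff, ← h.mem_boundary_iff]
    exact hab.2
  ext v
  rw [(h.refinement hab).mem_boundary_iff]
  rcases v with _ | v
  · simp only [Set.mem_image, reduceCtorEq, and_false, exists_false, iff_false]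
    rintro (e | e | e)
    exacts [h.ne a e.symm, h.ne b e.symm, hint ⟨e.1.symm, e.2.symm⟩]
  · simp only [Set.mem_image, Option.some.injEq, exists_eq_right, h.mem_boundary_iff]
    exact ⟨fun e => e.1, fun e => ⟨e, fun e => h.ne a e.1.symm, fun e => h.ne b e.1.symm⟩⟩

theorem IsCapping.interiorRefinement (h : IsCapping ι x) {V' : Type u} {G' : SimpleGraph V'}
    (hG : InteriorRefinement G G') :
    boundaryLength G' = boundaryLength G ∧
      ∃ (W' : Type u) (H' : SimpleGraph W') (x' : W') (ι' : G' ↪g H'), IsCapping ι' x' := by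
  induction hG with
  | refl => exact ⟨rfl, W, H, x, ι, h⟩
  | step a b _ hab ih =>
    obtain ⟨hlen, W', H', x', ι', h'⟩ := ih
    refine ⟨?_, _, _, _, _, h'.refinement hab⟩
    rw [boundaryLength, h'.boundary_refinement hab,
      Set.ncard_image_of_injective _ (Option.some_injective _)]
    exact hlen

theorem InteriorRefinement.trans {V₁ V₂ V₃ : Type u} {G₁ : SimpleGraph V₁} {G₂ : SimpleGraph V₂}
    {G₃ : SimpleGraph V₃} (h₁ : InteriorRefinement G₁ G₂) (h₂ : InteriorRefinement G₂ G₃) :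
    InteriorRefinement G₁ G₃ := by
  induction h₂ with
  | refl => exact h₁
  | step a b _ hab ih => exact .step a b ih hab

end

/-! ### Edges and triangles of a closed surface -/

/-- The Fredholm alternative: a linear form that vanishes on the common kernel of the rows of a
matrix is a combination of the rows. -/
theorem exists_vecMul_eq {K m n : Type*} [Field K] [Fintype m] [Fintype n]
    (M : Matrix m n K) (φ : n → K) (h : ∀ g, M.mulVec g = 0 → φ ⬝ᵥ g = 0) :
    ∃ c, Matrix.vecMul c M = φ := by
  classical
  let Φ : Module.Dual K (n → K) := dotProductBilin K K φ
  have hΦ : Φ ∈ LinearMap.range M.mulVecLin.dualMap := by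
    rw [LinearMap.range_dualMap_eq_dualAnnihilator_ker, Submodule.mem_dualAnnihilator]
    exact fun g hg => h g hg
  obtain ⟨ψ, hψ⟩ := hΦ
  refine ⟨fun i => ψ (Pi.single i 1), funext fun j => ?_⟩
  have h1 := LinearMap.congr_fun hψ (Pi.single j 1)
  have h2 : Φ (Pi.single j 1) = φ j := dotProduct_single_one φ j
  rw [h2] at h1
  rw [← h1, LinearMap.dualMap_apply, Matrix.mulVecLin_apply, Matrix.mulVec_single_one,
    LinearMap.pi_apply_eq_sum_univ ψ (M.col j)]
  exact Finset.sum_congr rfl fun i _ => by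
    rw [smul_eq_mul, mul_comm]
    congr 2
    refine congrArg ψ (funext fun k => ?_)
    simp [Pi.single_apply, eq_comm]

open Classical in
/-- The edges of a finite graph, as two-element sets of vertices. -/
noncomputable def edgePairs {W : Type u} [Fintype W] (H : SimpleGraph W) : Finset (Finset W) :=
  Finset.univ.filter fun e => ∃ a b, H.Adj a b ∧ e = {a, b}

section
open Classical
variable {W : Type u} [Fintype W] {H : SimpleGraph W}

theorem mem_edgePairs {e : Finset W} : e ∈ edgePairs H ↔ ∃ a b, H.Adj a b ∧ e = {a, b} := by
  simp [edgePairs]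

theorem mem_triangles {t : Finset W} : t ∈ H.cliqueFinset 3 ↔
    ∃ a b c, H.Adj a b ∧ H.Adj a c ∧ H.Adj b c ∧ t = {a, b, c} := by
  rw [SimpleGraph.mem_cliqueFinset_iff, SimpleGraph.is3Clique_iff]

theorem edgePairs_filter_subset {a b c : W} (hab : H.Adj a b) (hac : H.Adj a c)
    (hbc : H.Adj b c) :
    (edgePairs H).filter (· ⊆ ({a, b, c} : Finset W)) = {{a, b}, {a, c}, {b, c}} := by
  ext e
  simp only [Finset.mem_filter, mem_edgePairs, Finset.mem_insert, Finset.mem_singleton]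
  constructor
  · rintro ⟨⟨u, v, huv, rfl⟩, hs⟩
    have hu := hs (Finset.mem_insert_self u {v})
    have hv := hs (Finset.mem_insert_of_mem (Finset.mem_singleton_self v))
    simp only [Finset.mem_insert, Finset.mem_singleton] at hu hv
    have := huv.ne
    rcases hu with rfl | rfl | rfl <;> rcases hv with rfl | rfl | rfl <;>
      simp_all [Finset.pair_comm]
  · rintro (rfl | rfl | rfl)
    · exact ⟨⟨a, b, hab, rfl⟩, by grind⟩
    · exact ⟨⟨a, c, hac, rfl⟩, by grind⟩
    · exact ⟨⟨b, c, hbc, rfl⟩, by grind⟩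

theorem sum_edgePairs_filter_subset {M : Type*} [AddCommMonoid M] (f : Finset W → M) {a b c : W}
    (hab : H.Adj a b) (hac : H.Adj a c) (hbc : H.Adj b c) :
    ∑ e ∈ (edgePairs H).filter (· ⊆ ({a, b, c} : Finset W)), f e =
      f {a, b} + (f {a, c} + f {b, c}) := by
  have h1 := hab.ne
  have h2 := hac.ne
  have h3 := hbc.ne
  have m : ∀ {u v w : W}, w ≠ u → w ≠ v → ({u, v} : Finset W) ≠ {u, w} := by
    intro u v w h1 h2 h
    have : w ∈ ({u, v} : Finset W) := h ▸ by simp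
    simp [h1, h2] at this
  rw [edgePairs_filter_subset hab hac hbc, Finset.sum_insert, Finset.sum_pair]
  · rw [Finset.pair_comm a c, Finset.pair_comm b c]
    exact m h3 h1.symm
  · simp only [Finset.mem_insert, Finset.mem_singleton, not_or]
    refine ⟨m h2.symm h3.symm, ?_⟩
    rw [Finset.pair_comm a b]
    exact m h3.symm h2.symm

/-- Every edge of a closed surface lies in exactly two triangles. -/
theorem IsSurface.exists_triangles_eq_pair (h : IsSurface H) {e : Finset W}
    (he : e ∈ edgePairs H) : ∃ s t, s ≠ t ∧ (H.cliqueFinset 3).filter (e ⊆ ·) = {s, t} := by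
  obtain ⟨a, b, hab, rfl⟩ := mem_edgePairs.1 he
  obtain ⟨p, q, hpq, -, hp⟩ := h.common a b hab
  have hpp := (hp p).2 (.inl rfl)
  have hqq := (hp q).2 (.inr rfl)
  refine ⟨{a, b, p}, {a, b, q}, fun h => ?_, ?_⟩
  · have : p ∈ ({a, b, q} : Finset W) := h ▸ by simp
    have h1 := hpp.1.ne'
    have h2 := hpp.2.ne'
    simp [h1, h2, hpq] at this
  · ext t
    simp only [Finset.mem_filter, mem_triangles, Finset.mem_insert, Finset.mem_singleton]
    constructor
    · rintro ⟨⟨u, v, w, huv, huw, hvw, rfl⟩, hs⟩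
      have ha := hs (Finset.mem_insert_self a {b})
      have hb := hs (Finset.mem_insert_of_mem (Finset.mem_singleton_self b))
      simp only [Finset.mem_insert, Finset.mem_singleton] at ha hb
      have hne := hab.ne
      obtain ⟨z, haz, hbz, e⟩ : ∃ z, H.Adj a z ∧ H.Adj b z ∧
          ({u, v, w} : Finset W) = {a, b, z} := by
        rcases ha with rfl | rfl | rfl <;> rcases hb with rfl | rfl | rfl
        · exact absurd rfl hne
        · exact ⟨w, huw, hvw, rfl⟩
        · exact ⟨v, huv, hvw.symm, by grind⟩
        · exact ⟨w, hvw, huw, by grind⟩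
        · exact absurd rfl hne
        · exact ⟨u, huv.symm, huw.symm, by grind⟩
        · exact ⟨v, hvw.symm, huv, by grind⟩
        · exact ⟨u, huw.symm, huv.symm, by grind⟩
        · exact absurd rfl hne
      rw [e]
      rcases (hp z).1 ⟨haz, hbz⟩ with rfl | rfl
      exacts [.inl rfl, .inr rfl]
    · rintro (rfl | rfl)
      · exact ⟨⟨a, b, p, hab, hpp.1, hpp.2, rfl⟩, by grind⟩
      · exact ⟨⟨a, b, q, hab, hqq.1, hqq.2, rfl⟩, by grind⟩

theorem card_edgePairs_filter_mem {v : W} (P : W → Prop) (hv : P v) :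
    ((edgePairs H).filter fun e => (∀ w ∈ e, P w) ∧ v ∈ e).card =
      {w | H.Adj v w ∧ P w}.ncard := by
  have : ((edgePairs H).filter fun e => (∀ w ∈ e, P w) ∧ v ∈ e) =
      (Finset.univ.filter fun w => H.Adj v w ∧ P w).image fun w => {v, w} := by
    ext e
    simp only [Finset.mem_filter, mem_edgePairs, Finset.mem_image, Finset.mem_univ, true_and]
    constructor
    · rintro ⟨⟨a, b, hab, rfl⟩, hP, hve⟩
      simp only [Finset.mem_insert, Finset.mem_singleton] at hve
      rcases hve with rfl | rfl
      · exact ⟨b, ⟨hab, hP _ (by simp)⟩, rfl⟩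
      · exact ⟨a, ⟨hab.symm, hP _ (by simp)⟩, Finset.pair_comm _ _⟩
    · rintro ⟨w, ⟨hvw, hw⟩, rfl⟩
      exact ⟨⟨v, w, hvw, rfl⟩, by simp [hv, hw], by simp⟩
  rw [this, Finset.card_image_of_injOn, ← Set.ncard_coe_finset]
  · simp
  · intro w hw w' hw' hww
    have h1 : H.Adj v w := by simp at hw; exact hw.1
    have : w ∈ ({v, w'} : Finset W) := by
      have hww : ({v, w} : Finset W) = {v, w'} := hww
      rw [← hww]; simp
    simp only [Finset.mem_insert, Finset.mem_singleton] at this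
    exact this.resolve_left h1.ne'

end

/-! ### Eulerian balls have boundary length divisible by three -/

open Classical in
/-- If the first cohomology vanishes, every `ℤ/2`-cycle is the boundary of a chain of triangles:
here for the cycle of all edges inside a vertex set `P` in which all vertices have an even number
of neighbours. -/
theorem TrivialH1.exists_chain {W : Type u} [Fintype W] {H : SimpleGraph W} (h : TrivialH1 H)
    (P : W → Prop) (hP : ∀ v, P v → Even {w | H.Adj v w ∧ P w}.ncard) :
    ∃ c : Finset W → ZMod 2, ∀ e ∈ edgePairs H,
      ∑ t ∈ (H.cliqueFinset 3).filter (e ⊆ ·), c t = if ∀ w ∈ e, P w then 1 else 0 := by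
  let M : Matrix (Finset W) (Finset W) (ZMod 2) := fun t e =>
    if t ∈ H.cliqueFinset 3 ∧ e ∈ edgePairs H ∧ e ⊆ t then 1 else 0
  let φ : Finset W → ZMod 2 := fun e => if e ∈ edgePairs H ∧ ∀ w ∈ e, P w then 1 else 0
  obtain ⟨c, hc⟩ := exists_vecMul_eq M φ (by
    intro g hg
    obtain ⟨k, hk⟩ := h (fun a b => g {a, b}) (fun a b _ => by rw [Finset.pair_comm]) (by
      intro a b c hab hbc hac
      have h1 := congrFun hg {a, b, c}
      have hT : ({a, b, c} : Finset W) ∈ H.cliqueFinset 3 :=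
        mem_triangles.2 ⟨a, b, c, hab, hac, hbc, rfl⟩
      have h2 : M.mulVec g {a, b, c} =
          ∑ e ∈ (edgePairs H).filter (· ⊆ ({a, b, c} : Finset W)), g e := by
        simp only [Matrix.mulVec, dotProduct, M, hT, true_and, ite_mul, one_mul, zero_mul]
        rw [← Finset.sum_filter]
        refine Finset.sum_congr ?_ fun _ _ => rfl
        ext e
        simp
      rw [h2, sum_edgePairs_filter_subset g hab hac hbc, Pi.zero_apply] at h1
      have two : (2 : ZMod 2) = 0 := rfl
      linear_combination h1 - two * g {a, c})
    have hsum : φ ⬝ᵥ g = ∑ e ∈ (edgePairs H).filter (fun e => ∀ w ∈ e, P w), ∑ v ∈ e, k v := by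
      simp only [dotProduct, φ, ite_mul, one_mul, zero_mul]
      rw [← Finset.sum_filter]
      refine Finset.sum_congr (by ext e; simp) fun e he => ?_
      obtain ⟨a, b, hab, rfl⟩ := mem_edgePairs.1 (Finset.mem_filter.1 he).1
      rw [hk a b hab, Finset.sum_pair hab.ne]
    rw [hsum]
    have hswap : ∑ e ∈ (edgePairs H).filter (fun e => ∀ w ∈ e, P w), ∑ v ∈ e, k v =
        ∑ v, ∑ e ∈ (edgePairs H).filter (fun e => (∀ w ∈ e, P w) ∧ v ∈ e), k v := by
      refine Finset.sum_comm' fun e v => ?_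
      simp only [Finset.mem_filter, Finset.mem_univ, and_true]
      tauto
    rw [hswap]
    refine Finset.sum_eq_zero fun v _ => ?_
    rw [Finset.sum_const]
    by_cases hv : P v
    · rw [card_edgePairs_filter_mem P hv]
      obtain ⟨r, hr⟩ := hP v hv
      rw [hr, nsmul_eq_mul, Nat.cast_add, CharTwo.add_self_eq_zero, zero_mul]
    · rw [Finset.filter_false_of_mem fun e _ he => hv (he.1 v he.2), Finset.card_empty,
        zero_smul])
  refine ⟨c, fun e he => ?_⟩
  have h1 := congrFun hc e
  have h2 : φ e = if ∀ w ∈ e, P w then 1 else 0 := by simp only [φ, he, true_and]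
  rw [← h2, ← h1]
  simp only [Matrix.vecMul, dotProduct, M, he, true_and, mul_ite, mul_one, mul_zero]
  rw [← Finset.sum_filter]
  refine Finset.sum_congr ?_ fun _ _ => rfl
  ext t
  simp

/-- Let `c` be a chain of triangles whose boundary consists of all edges not containing `x`, and
count a triangle as `1` or `-1` according to whether it belongs to `c`. Every edge away from `x`
lies in two triangles of opposite sign, whereas all triangles at `x` have the same sign. Summing
over all pairs of an edge and a triangle containing it shows that three times the sum of all
signs is, up to sign, twice the degree of `x`. -/
theorem IsSurface.three_dvd_of_chain {W : Type u} [Fintype W] {H : SimpleGraph W}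
    (hH : IsSurface H) (x : W) (h : TrivialH1 H)
    (hx : ∀ v, v ≠ x → Even {w | H.Adj v w ∧ w ≠ x}.ncard) :
    3 ∣ {w | H.Adj x w}.ncard := by
  classical
  obtain ⟨c, hc⟩ := h.exists_chain (· ≠ x) hx
  let s : Finset W → ℤ := fun t => if c t = 1 then 1 else -1
  have hs : ∀ t, s t = 1 ∨ s t = -1 := fun t => by
    by_cases h : c t = 1 <;> simp [s, h]
  have hz : ∀ z : ZMod 2, z = 0 ∨ z = 1 := by decide
  have hxe : ∀ e : Finset W, (∀ w ∈ e, w ≠ x) ↔ x ∉ e := fun e =>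
    ⟨fun h hx => h x hx rfl, fun h w hw e => h (e ▸ hw)⟩
  have hc' : ∀ e ∈ edgePairs H, ∃ t t', t ≠ t' ∧
      (H.cliqueFinset 3).filter (e ⊆ ·) = {t, t'} ∧ (x ∈ e → s t = s t') ∧
      (x ∉ e → s t + s t' = 0) := by
    intro e he
    obtain ⟨t, t', hne, htt⟩ := hH.exists_triangles_eq_pair he
    have h1 := hc e he
    rw [htt, Finset.sum_pair hne] at h1
    simp only [hxe] at h1
    refine ⟨t, t', hne, htt, fun hx => ?_, fun hx => ?_⟩
    · rw [if_neg (not_not.2 hx)] at h1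
      rcases hz (c t) with e1 | e1 <;> rcases hz (c t') with e2 | e2 <;> simp_all [s]
    · rw [if_pos hx] at h1
      rcases hz (c t) with e1 | e1 <;> rcases hz (c t') with e2 | e2 <;> simp_all [s]
  have hsame : ∀ e ∈ edgePairs H, x ∈ e → ∀ t ∈ H.cliqueFinset 3, ∀ t' ∈ H.cliqueFinset 3,
      e ⊆ t → e ⊆ t' → s t = s t' := by
    intro e he hx t ht t' ht' het het'
    obtain ⟨u, u', -, huu, h1, -⟩ := hc' e he
    have e1 : t ∈ (H.cliqueFinset 3).filter (e ⊆ ·) := Finset.mem_filter.2 ⟨ht, het⟩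
    have e2 : t' ∈ (H.cliqueFinset 3).filter (e ⊆ ·) := Finset.mem_filter.2 ⟨ht', het'⟩
    rw [huu, Finset.mem_insert, Finset.mem_singleton] at e1 e2
    have := h1 hx
    rcases e1 with rfl | rfl <;> rcases e2 with rfl | rfl <;> simp_all
  obtain ⟨⟨v₀, hv₀⟩, hcon⟩ := (unitSphere_connected_iff H x).1 (hH.connected x)
  have hpair : ∀ v, H.Adj x v → ({x, v} : Finset W) ∈ edgePairs H := fun v hv =>
    mem_edgePairs.2 ⟨x, v, hv, rfl⟩
  obtain ⟨t₀, _, _, ht₀, _⟩ := hc' _ (hpair v₀ hv₀)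
  have ht₀ : t₀ ∈ H.cliqueFinset 3 ∧ {x, v₀} ⊆ t₀ := by
    rw [← Finset.mem_filter, ht₀]
    exact Finset.mem_insert_self _ _
  have hconst : ∀ v, H.Adj x v → ∀ t ∈ H.cliqueFinset 3, {x, v} ⊆ t → s t = s t₀ := by
    intro v hv
    refine hcon (fun v => ∀ t ∈ H.cliqueFinset 3, {x, v} ⊆ t → s t = s t₀) ?_ v₀ v hv₀ hv
      fun t ht hxt => hsame _ (hpair v₀ hv₀) (by simp) t ht t₀ ht₀.1 hxt ht₀.2
    intro y z hy hz hyz hall t ht hxt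
    have hT : ({x, y, z} : Finset W) ∈ H.cliqueFinset 3 :=
      mem_triangles.2 ⟨x, y, z, hy, hz, hyz, rfl⟩
    rw [← hall _ hT (by grind)]
    exact hsame _ (hpair z hz) (by simp) t ht _ hT hxt (by grind)
  have hcount : ∑ e ∈ edgePairs H, ∑ t ∈ (H.cliqueFinset 3).filter (e ⊆ ·), s t =
      ∑ t ∈ H.cliqueFinset 3, 3 * s t := by
    rw [Finset.sum_comm' (t' := H.cliqueFinset 3)
      (s' := fun t => (edgePairs H).filter (· ⊆ t)) (by
        intro e t
        simp only [Finset.mem_filter]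
        tauto)]
    refine Finset.sum_congr rfl fun t ht => ?_
    obtain ⟨a, b, d, hab, had, hbd, rfl⟩ := mem_triangles.1 ht
    rw [sum_edgePairs_filter_subset (fun _ => s {a, b, d}) hab had hbd]
    ring
  have hcount' : ∑ e ∈ edgePairs H, ∑ t ∈ (H.cliqueFinset 3).filter (e ⊆ ·), s t =
      ∑ e ∈ edgePairs H, if x ∈ e then 2 * s t₀ else 0 := by
    refine Finset.sum_congr rfl fun e he => ?_
    obtain ⟨t, t', hne, htt, h1, h2⟩ := hc' e he
    rw [htt, Finset.sum_pair hne]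
    split_ifs with hx
    · have ht : t ∈ H.cliqueFinset 3 ∧ e ⊆ t := by
        rw [← Finset.mem_filter, htt]
        exact Finset.mem_insert_self _ _
      obtain ⟨v, hv, rfl⟩ : ∃ v, H.Adj x v ∧ e = {x, v} := by
        obtain ⟨a, b, hab, rfl⟩ := mem_edgePairs.1 he
        rcases Finset.mem_insert.1 hx with rfl | hx
        · exact ⟨b, hab, rfl⟩
        · obtain rfl := Finset.mem_singleton.1 hx
          exact ⟨a, hab.symm, Finset.pair_comm _ _⟩
      rw [← h1 hx, hconst v hv t ht.1 ht.2]
      ring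
    · exact h2 hx
  have hdeg := card_edgePairs_filter_mem (H := H) (v := x) (fun _ => True) trivial
  simp only [implies_true, true_and, and_true] at hdeg
  rw [hcount, ← Finset.mul_sum, ← Finset.sum_filter, Finset.sum_const, hdeg, nsmul_eq_mul]
    at hcount'
  rcases hs t₀ with e | e <;> rw [e] at hcount' <;> omega

theorem IsCapping.three_dvd_boundaryLength {V W : Type u} {G : SimpleGraph V}
    {H : SimpleGraph W} {ι : G ↪g H} {x : W} (h : IsCapping ι x) (hG : IsEulerian G) :
    3 ∣ boundaryLength G := by
  have := h.surface.finite
  have := Fintype.ofFinite W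
  have himage : ∀ P : W → Prop, (∀ w, P w → w ≠ x) → {w | P w}.ncard = {v | P (ι v)}.ncard := by
    intro P hP
    rw [← Set.ncard_image_of_injective _ ι.injective]
    congr 1
    ext w
    constructor
    · intro hw
      obtain ⟨v, rfl⟩ := h.exists_eq (hP w hw)
      exact ⟨v, hw, rfl⟩
    · rintro ⟨v, hv, rfl⟩
      exact hv
  have hlen : boundaryLength G = {w | H.Adj x w}.ncard := by
    rw [himage _ fun w hw => hw.ne', boundaryLength]
    congr 1
    ext v
    exact h.mem_boundary_iff
  rw [hlen]
  refine h.surface.three_dvd_of_chain x h.trivialH1 fun w hw => ?_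
  obtain ⟨v, rfl⟩ := h.exists_eq hw
  rw [himage _ fun w hw => hw.2]
  convert hG v using 2
  ext u
  simp [h.ne u]

/-! ### Colourings with three colours -/

/-- A discrete circle whose length is divisible by `3` can be coloured `0, 1, 2, 0, 1, 2, …` along
the circle. -/
theorem IsSphere.exists_cyclic_coloring {V : Type u} {S : SimpleGraph V} (h : IsSphere 1 S)
    (h3 : 3 ∣ Nat.card V) : ∃ f : V → ZMod 3, (∀ u v, S.Adj u v → f u ≠ f v) ∧
      ∀ v u w, S.Adj v u → S.Adj v w → u ≠ w → f u ≠ f w := by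
  obtain ⟨hfin, hconn, h2⟩ := isSphere_one_iff.1 h
  have hcyc : S.IsCycles := by
    intro v _
    obtain ⟨p, q, hne, -, hall⟩ := h2 v
    have : S.neighborSet v = {p, q} := by ext z; simp [hall]
    rw [this, Set.ncard_pair hne]
  obtain ⟨v₀⟩ := hconn.nonempty
  obtain ⟨p, hp, hverts⟩ := hcyc.exists_cycle_toSubgraph_verts_eq_connectedComponentSupp
    (c := S.connectedComponentMk v₀) (v := v₀) rfl (by
      obtain ⟨p, q, -, -, hall⟩ := h2 v₀
      exact ⟨p, (hall p).2 (.inl rfl)⟩)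
  have hlen := hp.three_le_length
  -- every vertex occurs exactly once at a position between `1` and the length of the cycle
  have hsupp : ∀ v, ∃ i, 1 ≤ i ∧ i ≤ p.length ∧ p.getVert i = v := by
    intro v
    have hv : v ∈ p.toSubgraph.verts := by
      rw [hverts]
      exact SimpleGraph.ConnectedComponent.sound (hconn.preconnected v v₀)
    rw [SimpleGraph.Walk.mem_verts_toSubgraph,
      SimpleGraph.Walk.mem_support_iff_exists_getVert] at hv
    obtain ⟨i, hi, hil⟩ := hv
    rcases Nat.eq_zero_or_pos i with rfl | hi0
    · exact ⟨p.length, by omega, le_rfl, by rw [← hi]; simp⟩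
    · exact ⟨i, hi0, hil, hi⟩
  choose idx hidx1 hidx2 hidx using hsupp
  have hidx_get : ∀ i, 1 ≤ i → i ≤ p.length → idx (p.getVert i) = i := fun i h1 h2 =>
    hp.getVert_injOn ⟨hidx1 _, hidx2 _⟩ ⟨h1, h2⟩ (hidx _)
  have hcard : Nat.card V = p.length := by
    rw [← Nat.card_fin p.length]
    refine Nat.card_congr (Equiv.ofBijective (fun v => (⟨idx v - 1, by
      have := hidx1 v; have := hidx2 v; omega⟩ : Fin p.length)) ⟨fun v w hvw => ?_, fun i => ?_⟩)
    · have h1 := hidx1 v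
      have h2 := hidx1 w
      have h3 : idx v - 1 = idx w - 1 := congrArg Fin.val hvw
      rw [← hidx v, ← hidx w, show idx v = idx w by omega]
    · exact ⟨p.getVert (i + 1), Fin.ext (by
        simp only [hidx_get (i + 1) (by omega) (by omega), Nat.add_sub_cancel])⟩
  rw [hcard] at h3
  have hlen0 : (p.length : ZMod 3) = 0 := (ZMod.natCast_eq_zero_iff _ _).2 h3
  have hf : ∀ i, i ≤ p.length → (idx (p.getVert i) : ZMod 3) = i := by
    intro i hi
    rcases Nat.eq_zero_or_pos i with rfl | hi0
    · have := hidx_get p.length (by omega) le_rfl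
      rw [SimpleGraph.Walk.getVert_length] at this
      rw [SimpleGraph.Walk.getVert_zero, this, hlen0, Nat.cast_zero]
    · rw [hidx_get i hi0 hi]
  -- both neighbours of a vertex, with their colours
  have key : ∀ v, ∃ s t, (∀ z, S.Adj v z ↔ z = s ∨ z = t) ∧
      (idx s : ZMod 3) = idx v - 1 ∧ (idx t : ZMod 3) = idx v + 1 := by
    intro v
    obtain ⟨i, hi1, hil, rfl⟩ : ∃ i, 1 ≤ i ∧ i ≤ p.length ∧ p.getVert i = v :=
      ⟨idx v, hidx1 v, hidx2 v, hidx v⟩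
    have hprev : S.Adj (p.getVert i) (p.getVert (i - 1)) := by
      have := p.adj_getVert_succ (i := i - 1) (by omega)
      rw [Nat.sub_add_cancel hi1] at this
      exact this.symm
    have hfprev : (idx (p.getVert (i - 1)) : ZMod 3) = idx (p.getVert i) - 1 := by
      rw [hf _ (by omega), hf _ hil, Nat.cast_sub hi1, Nat.cast_one]
    obtain ⟨t, ht, hft⟩ : ∃ t, S.Adj (p.getVert i) t ∧
        (idx t : ZMod 3) = idx (p.getVert i) + 1 := by
      rcases hil.lt_or_eq with hlt | rfl
      · exact ⟨_, p.adj_getVert_succ hlt, by rw [hf _ hil, hf _ hlt, Nat.cast_succ]⟩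
      · refine ⟨p.getVert 1, p.getVert_length.symm ▸ ?_, by
          rw [hf _ hil, hf _ hi1, hlen0, zero_add, Nat.cast_one]⟩
        have := p.adj_getVert_succ (i := 0) (by omega)
        rwa [SimpleGraph.Walk.getVert_zero] at this
    have hne : p.getVert (i - 1) ≠ t := by
      rintro e
      rw [e, hft] at hfprev
      have : ∀ z : ZMod 3, z + 1 ≠ z - 1 := by decide
      exact this _ hfprev
    refine ⟨p.getVert (i - 1), t, fun z => ?_, hfprev, hft⟩
    obtain ⟨y, y', -, -, hy⟩ := h2 (p.getVert i)
    have e1 := (hy _).1 hprev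
    have e2 := (hy _).1 ht
    rw [hy]
    grind
  have d1 : ∀ z : ZMod 3, z ≠ z - 1 ∧ z ≠ z + 1 ∧ z - 1 ≠ z + 1 := by decide
  refine ⟨fun v => idx v, fun u v huv => ?_, fun v u w hu hw huw => ?_⟩
  · obtain ⟨s, t, hst, hs, ht⟩ := key u
    beta_reduce
    rcases (hst v).1 huv with rfl | rfl
    · rw [hs]; exact (d1 _).1
    · rw [ht]; exact (d1 _).2.1
  · obtain ⟨s, t, hst, hs, ht⟩ := key v
    beta_reduce
    rcases (hst u).1 hu with rfl | rfl <;> rcases (hst w).1 hw with rfl | rfl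
    · exact absurd rfl huw
    · rw [hs, ht]; exact (d1 _).2.2
    · rw [hs, ht]; exact (d1 _).2.2.symm
    · exact absurd rfl huw

/-- A vertex colouring of `G` with three colours whose restriction to the boundary circle is of
the form `0, 1, 2, 0, 1, 2, …`, up to a permutation of the colours: the ends of a boundary edge,
and the two neighbours of a vertex on the circle, have different colours. -/
structure IsBoundaryColoring {V : Type u} (G : SimpleGraph V) (f : V → ZMod 3) : Prop where
  adj : ∀ u v, u ∈ boundary G → v ∈ boundary G → G.Adj u v → f u ≠ f v
  next : ∀ v u w, v ∈ boundary G → u ∈ boundary G → w ∈ boundary G →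
    G.Adj v u → G.Adj v w → u ≠ w → f u ≠ f w

/-- The monochromatic edges, each counted with both orientations. -/
def monochromatic {V : Type u} (G : SimpleGraph V) (f : V → ZMod 3) : Set (V × V) :=
  {e | G.Adj e.1 e.2 ∧ f e.1 = f e.2}

section
variable {V W : Type u} {G : SimpleGraph V} {H : SimpleGraph W} {ι : G ↪g H} {x : W}

theorem IsCapping.exists_isBoundaryColoring (h : IsCapping ι x) (h3 : 3 ∣ boundaryLength G) :
    ∃ f, IsBoundaryColoring G f := by
  classical
  have hcard : Nat.card (H.neighborSet x) = boundaryLength G := by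
    rw [boundaryLength, ← Set.ncard_image_of_injective _ ι.injective, Nat.card_coe_set_eq]
    congr 1
    ext w
    constructor
    · intro hw
      have hw' : H.Adj x w := hw
      obtain ⟨v, rfl⟩ := h.exists_eq hw'.ne'
      exact ⟨v, h.mem_boundary_iff.2 hw, rfl⟩
    · rintro ⟨v, hv, rfl⟩
      exact h.mem_boundary_iff.1 hv
  obtain ⟨f, hf1, hf2⟩ := (h.surface.isSphere_unitSphere x).exists_cyclic_coloring (hcard ▸ h3)
  let g : V → ZMod 3 := fun v =>
    if hv : ι v ∈ H.neighborSet x then f ⟨ι v, hv⟩ else 0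
  have hg : ∀ v (hv : v ∈ boundary G), g v = f ⟨ι v, h.mem_boundary_iff.1 hv⟩ :=
    fun v hv => dif_pos (h.mem_boundary_iff.1 hv)
  refine ⟨g, fun u v hu hv huv => ?_, fun v u w hv hu hw hvu hvw huw => ?_⟩
  · rw [hg u hu, hg v hv]
    exact hf1 _ _ (ι.map_adj_iff.2 huv)
  · rw [hg u hu, hg w hw]
    exact hf2 ⟨ι v, h.mem_boundary_iff.1 hv⟩ _ _ (ι.map_adj_iff.2 hvu) (ι.map_adj_iff.2 hvw)
      fun e => huw (ι.injective (congrArg Subtype.val e))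

theorem IsBoundaryColoring.refinement {f : V → ZMod 3} (hf : IsBoundaryColoring G f)
    (h : IsCapping ι x) {a b : V} (hab : IsInteriorEdge G a b) (k : ZMod 3) :
    IsBoundaryColoring (edgeRefinement G a b) (fun o => o.elim k f) := by
  constructor
  · rw [h.boundary_refinement hab]
    rintro _ _ ⟨u, hu, rfl⟩ ⟨v, hv, rfl⟩ huv
    exact hf.adj u v hu hv huv.1
  · rw [h.boundary_refinement hab]
    rintro _ _ _ ⟨v, hv, rfl⟩ ⟨u, hu, rfl⟩ ⟨w, hw, rfl⟩ hvu hvw huw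
    exact hf.next v u w hv hu hw hvu.1 hvw.1 fun e => huw (congrArg some e)

/-- In a ball, an interior edge has exactly two common neighbours. -/
theorem IsCapping.common (h : IsCapping ι x) {a b : V} (hab : IsInteriorEdge G a b) :
    ∃ c d, c ≠ d ∧ ¬ G.Adj c d ∧ ∀ z, (G.Adj a z ∧ G.Adj b z) ↔ z = c ∨ z = d := by
  obtain ⟨p, q, hpq, hn, hp⟩ := h.surface.common _ _ (ι.map_adj_iff.2 hab.1)
  have hx : ∀ z, H.Adj (ι a) z ∧ H.Adj (ι b) z → z ≠ x := by
    rintro z hz rfl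
    exact hab.2 ⟨h.mem_boundary_iff.2 hz.1.symm, h.mem_boundary_iff.2 hz.2.symm⟩
  obtain ⟨c, rfl⟩ := h.exists_eq (hx p ((hp p).2 (.inl rfl)))
  obtain ⟨d, rfl⟩ := h.exists_eq (hx q ((hp q).2 (.inr rfl)))
  refine ⟨c, d, fun e => hpq (e ▸ rfl), fun e => hn (ι.map_adj_iff.2 e), fun z => ?_⟩
  rw [← ι.injective.eq_iff, ← ι.injective.eq_iff (a := z), ← hp]
  exact and_congr ι.map_adj_iff.symm ι.map_adj_iff.symm

/-- Refining a monochromatic edge removes it from the set of monochromatic edges if the colour of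
the new vertex differs from those of its neighbours. -/
theorem ncard_monochromatic_refinement_lt [Finite V] {f : V → ZMod 3} {a b : V} {k : ZMod 3}
    (hab : G.Adj a b) (hf : f a = f b) (hk : k ≠ f a)
    (hc : ∀ z, G.Adj a z → G.Adj b z → f z ≠ k) :
    (monochromatic (edgeRefinement G a b) (fun o => o.elim k f)).ncard <
      (monochromatic G f).ncard := by
  have hnone : ∀ z, (edgeRefinement G a b).Adj none (some z) → f z ≠ k := by
    rintro z (rfl | rfl | hz)
    exacts [hk.symm, hf ▸ hk.symm, hc z hz.1 hz.2]
  have hmem : (a, b) ∈ monochromatic G f := ⟨hab, hf⟩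
  rw [← Set.ncard_sdiff_singleton_add_one hmem, Nat.lt_succ_iff,
    ← Set.ncard_image_of_injective (monochromatic G f \ {(a, b)})
      (f := Prod.map some some) ((Option.some_injective V).prodMap (Option.some_injective V))]
  refine Set.ncard_le_ncard ?_ (Set.toFinite _)
  rintro ⟨_ | u, _ | v⟩ ⟨huv, hfuv⟩
  · exact huv.elim
  · exact absurd hfuv.symm (hnone v huv)
  · exact absurd hfuv (hnone u huv.symm)
  · exact ⟨(u, v), ⟨⟨huv.1, hfuv⟩, fun e => huv.2.1 (Prod.ext_iff.1 e)⟩, rfl⟩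

/-- If exactly one neighbour of the new vertex has its colour, then the refined monochromatic edge
is replaced by another one. -/
theorem ncard_monochromatic_refinement_le [Finite V] {f : V → ZMod 3} {a b c : V}
    (hab : G.Adj a b) (hf : f a = f b) (hk : f c ≠ f a)
    (hc : ∀ z, G.Adj a z → G.Adj b z → z ≠ c → f z ≠ f c) :
    (monochromatic (edgeRefinement G a b) (fun o => o.elim (f c) f)).ncard ≤
      (monochromatic G f).ncard := by
  have hnone : ∀ z, (edgeRefinement G a b).Adj none (some z) → f z = f c → z = c := by
    rintro z (rfl | rfl | hz) e
    · exact absurd e.symm hk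
    · exact absurd (e.symm.trans hf.symm) hk
    · by_contra hne
      exact hc z hz.1 hz.2 hne e
  have hsub : ({(a, b), (b, a)} : Set (V × V)) ⊆ monochromatic G f := by
    rintro _ (rfl | rfl)
    exacts [⟨hab, hf⟩, ⟨hab.symm, hf.symm⟩]
  have h2 : ({(a, b), (b, a)} : Set (V × V)).ncard = 2 :=
    Set.ncard_pair fun e => hab.ne (Prod.ext_iff.1 e).1
  rw [← Set.ncard_sdiff_add_ncard_of_subset hsub, h2,
    ← Set.ncard_image_of_injective (monochromatic G f \ _)
      (f := Prod.map some some) ((Option.some_injective V).prodMap (Option.some_injective V))]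
  have h2' : ({(none, some c), (some c, none)} : Set (Option V × Option V)).ncard ≤ 2 :=
    (Set.ncard_insert_le _ _).trans (by rw [Set.ncard_singleton])
  refine le_trans (Set.ncard_le_ncard ?_ (Set.toFinite _)) ((Set.ncard_union_le _ _).trans
    (Nat.add_le_add_left h2' _))
  rintro ⟨_ | u, _ | v⟩ ⟨huv, hfuv⟩
  · exact huv.elim
  · exact .inr (.inl (by rw [hnone v huv hfuv.symm]))
  · exact .inr (.inr (by rw [hnone u huv.symm hfuv]; rfl))
  · refine .inl ⟨(u, v), ⟨⟨huv.1, hfuv⟩, ?_⟩, rfl⟩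
    rintro (e | e)
    exacts [huv.2.1 (Prod.ext_iff.1 e), huv.2.2 (Prod.ext_iff.1 e)]

end

/-! ### Removing monochromatic edges -/

section
variable {V W : Type u} {G : SimpleGraph V} {H : SimpleGraph W} {ι : G ↪g H} {x : W}

theorem zmod_three_eq_of_ne {i j k l : ZMod 3} (hij : i ≠ j) (hik : i ≠ k) (hjk : j ≠ k)
    (hli : l ≠ i) (hlj : l ≠ j) : l = k := by
  have key : ∀ i j k l : ZMod 3, (i ≠ j ∧ i ≠ k ∧ j ≠ k) ∧ l ≠ i ∧ l ≠ j → l = k := by decide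
  exact key i j k l ⟨⟨hij, hik, hjk⟩, hli, hlj⟩

open Classical in
/-- In the link of a vertex `v`, a proper colouring uses the two colours other than that of `v`.
Both colour classes have the same size: count the edges of the link between them, where in the
link of a boundary vertex each colour occurs at exactly one of the two end points. -/
theorem IsCapping.isEulerian_of_coloring (h : IsCapping ι x) {f : V → ZMod 3}
    (hf : IsBoundaryColoring G f) (hp : ∀ u v, G.Adj u v → f u ≠ f v) : IsEulerian G := by
  have hfin : Finite V := by
    have := h.surface.finite
    exact Finite.of_injective ι ι.injective
  have := Fintype.ofFinite V
  intro v
  obtain ⟨k, l, hk, hl, hkl⟩ : ∃ k l : ZMod 3, k ≠ f v ∧ l ≠ f v ∧ k ≠ l := by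
    have : ∀ z : ZMod 3, ∃ k l : ZMod 3, k ≠ z ∧ l ≠ z ∧ k ≠ l := by decide
    exact this _
  let A : ZMod 3 → Finset V := fun k => Finset.univ.filter fun y => G.Adj v y ∧ f y = k
  have hA : ∀ {k y}, y ∈ A k ↔ G.Adj v y ∧ f y = k := by simp [A]
  -- the number of neighbours of `y` in the link of `v`
  have hlink : ∀ y, G.Adj v y → {z | G.Adj v z ∧ G.Adj y z}.ncard +
      (if v ∈ boundary G ∧ y ∈ boundary G then 1 else 0) = 2 := by
    intro y hy
    obtain ⟨p, q, hpq, -, hc⟩ := h.surface.common _ _ (ι.map_adj_iff.2 hy)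
    have himage : ι '' {z | G.Adj v z ∧ G.Adj y z} = {p, q} \ {x} := by
      ext w
      constructor
      · rintro ⟨z, hz, rfl⟩
        exact ⟨(hc _).1 ⟨ι.map_adj_iff.2 hz.1, ι.map_adj_iff.2 hz.2⟩, h.ne z⟩
      · rintro ⟨hw, hwx⟩
        obtain ⟨z, rfl⟩ := h.exists_eq hwx
        have := (hc _).2 hw
        exact ⟨z, ⟨ι.map_adj_iff.1 this.1, ι.map_adj_iff.1 this.2⟩, rfl⟩
    have hiff : (v ∈ boundary G ∧ y ∈ boundary G) ↔ x ∈ ({p, q} : Set W) := by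
      rw [h.mem_boundary_iff, h.mem_boundary_iff, H.adj_comm x, H.adj_comm x]
      exact hc x
    rw [← Set.ncard_image_of_injective _ ι.injective, himage]
    simp only [hiff]
    by_cases hx : x ∈ ({p, q} : Set W)
    · rw [if_pos hx, Set.ncard_sdiff_singleton_add_one hx, Set.ncard_pair hpq]
    · rw [if_neg hx, Set.sdiff_singleton_eq_self hx, Set.ncard_pair hpq]
  have hbd : v ∈ boundary G → ∀ k, k ≠ f v →
      ((A k).filter fun y => y ∈ boundary G).card = 1 := by
    intro hv k hk
    obtain ⟨p, q, hpq, -, hc⟩ := h.surface.common _ _ (h.mem_boundary_iff.1 hv)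
    have hpp := (hc p).2 (.inl rfl)
    have hqq := (hc q).2 (.inr rfl)
    obtain ⟨p, rfl⟩ := h.exists_eq hpp.1.ne'
    obtain ⟨q, rfl⟩ := h.exists_eq hqq.1.ne'
    have hpb := h.mem_boundary_iff.2 hpp.1
    have hqb := h.mem_boundary_iff.2 hqq.1
    have hvp := ι.map_adj_iff.1 hpp.2
    have hvq := ι.map_adj_iff.1 hqq.2
    have hfpq := hf.next v p q hv hpb hqb hvp hvq fun e => hpq (e ▸ rfl)
    have hmem : ∀ y, y ∈ (A k).filter (fun y => y ∈ boundary G) ↔ (y = p ∨ y = q) ∧ f y = k := by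
      intro y
      rw [Finset.mem_filter, hA, h.mem_boundary_iff, ← ι.injective.eq_iff (a := y),
        ← ι.injective.eq_iff (a := y), ← hc, ι.map_adj_iff]
      tauto
    rw [Finset.card_eq_one]
    by_cases hkp : k = f p
    · refine ⟨p, ?_⟩
      ext y
      rw [hmem, Finset.mem_singleton]
      constructor
      · rintro ⟨rfl | rfl, hy⟩
        · rfl
        · exact absurd (hkp.symm.trans hy.symm) hfpq
      · rintro rfl
        exact ⟨.inl rfl, hkp.symm⟩
    · have hkq : k = f q := zmod_three_eq_of_ne (hp v p hvp) (hp v q hvq) hfpq hk hkp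
      refine ⟨q, ?_⟩
      ext y
      rw [hmem, Finset.mem_singleton]
      constructor
      · rintro ⟨rfl | rfl, hy⟩
        · exact absurd hy.symm hkp
        · rfl
      · rintro rfl
        exact ⟨.inr rfl, hkq.symm⟩
  have hcount : ∀ k l, k ≠ f v → l ≠ f v → k ≠ l →
      ∑ y ∈ A k, (Finset.bipartiteAbove G.Adj (A l) y).card +
        (if v ∈ boundary G then 1 else 0) = (A k).card * 2 := by
    intro k l hk hl hkl
    have h1 : ∀ y ∈ A k, (Finset.bipartiteAbove G.Adj (A l) y).card +
        (if v ∈ boundary G ∧ y ∈ boundary G then 1 else 0) = 2 := by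
      intro y hy
      rw [hA] at hy
      rw [← hlink y hy.1, ← Set.ncard_coe_finset]
      congr 2
      ext z
      simp only [Finset.bipartiteAbove, Finset.coe_filter, hA, Set.mem_ofPred_eq]
      constructor
      · exact fun hz => ⟨hz.1.1, hz.2⟩
      · intro hz
        refine ⟨⟨hz.1, zmod_three_eq_of_ne hk.symm hl.symm hkl (hp v z hz.1).symm ?_⟩, hz.2⟩
        rw [← hy.2]
        exact (hp y z hz.2).symm
    rw [← Finset.sum_const_nat h1, Finset.sum_add_distrib]
    congr 1
    split_ifs with hv
    · simp only [hv, true_and]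
      rw [← Finset.card_filter, hbd hv k hk]
    · simp [hv]
  have h1 := hcount k l hk hl hkl
  have h2 := hcount l k hl hk hkl.symm
  rw [Finset.sum_card_bipartiteAbove_eq_sum_card_bipartiteBelow] at h1
  have h3 : ∀ y, (Finset.bipartiteBelow G.Adj (A k) y) = Finset.bipartiteAbove G.Adj (A k) y := by
    intro y
    ext z
    simp [Finset.bipartiteBelow, Finset.bipartiteAbove, G.adj_comm]
  simp only [h3] at h1
  have hunion : G.neighborSet v = ↑(A k ∪ A l) := by
    ext z
    simp only [SimpleGraph.mem_neighborSet, Finset.coe_union, Set.mem_union, Finset.mem_coe, hA,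
      ← and_or_left]
    refine ⟨fun hz => ⟨hz, ?_⟩, fun hz => hz.1⟩
    by_cases hzk : f z = k
    · exact .inl hzk
    · exact .inr (zmod_three_eq_of_ne hk.symm hl.symm hkl (hp v z hz).symm hzk)
  have hdisj : Disjoint (A k) (A l) := Finset.disjoint_left.2 fun y hy hy' =>
    hkl ((hA.1 hy).2.symm.trans (hA.1 hy').2)
  rw [hunion, Set.ncard_coe_finset, Finset.card_union_of_disjoint hdisj]
  exact ⟨(A l).card, by omega⟩

/-- A monochromatic edge can be removed by one or two interior refinements. If its ends and the
two opposite vertices use at most two colours, the new vertex gets a third colour. Otherwise it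
gets the colour of an opposite vertex `c`, and the new monochromatic edge to `c` is refined next:
the vertices opposite to it are the ends of the original edge, which have the same colour. -/
theorem IsCapping.exists_isEulerian (h : IsCapping ι x) {f : V → ZMod 3}
    (hf : IsBoundaryColoring G f) :
    ∃ (V' : Type u) (G' : SimpleGraph V'), InteriorRefinement G G' ∧ IsEulerian G' := by
  obtain ⟨n, hn⟩ : ∃ n, (monochromatic G f).ncard = n := ⟨_, rfl⟩
  induction n using Nat.strong_induction_on generalizing V W with
  | _ n ih =>
    subst hn
    have hfin : Finite V := by
      have := h.surface.finite
      exact Finite.of_injective ι ι.injective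
    by_cases hp : ∀ u v, G.Adj u v → f u ≠ f v
    · exact ⟨V, G, .refl, h.isEulerian_of_coloring hf hp⟩
    push Not at hp
    obtain ⟨a, b, hab, hfab⟩ := hp
    have hint : IsInteriorEdge G a b := ⟨hab, fun hb => hf.adj a b hb.1 hb.2 hab hfab⟩
    obtain ⟨c, d, hcd, hncd, hc⟩ := h.common hint
    by_cases hk : ∃ k, k ≠ f a ∧ k ≠ f c ∧ k ≠ f d
    · obtain ⟨k, hka, hkc, hkd⟩ := hk
      obtain ⟨V', G', hG', hE⟩ := ih _ (ncard_monochromatic_refinement_lt hab hfab hka (by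
        intro z hz1 hz2
        rcases (hc z).1 ⟨hz1, hz2⟩ with rfl | rfl
        exacts [hkc.symm, hkd.symm])) (h.refinement hint) (hf.refinement h hint k) rfl
      exact ⟨V', G', .trans (.step a b .refl hint) hG', hE⟩
    · obtain ⟨hca, hda, hfcd⟩ : f c ≠ f a ∧ f d ≠ f a ∧ f c ≠ f d := by
        have : ∀ i j k : ZMod 3, (¬ ∃ l, l ≠ i ∧ l ≠ j ∧ l ≠ k) → j ≠ i ∧ k ≠ i ∧ j ≠ k := by
          decide
        exact this _ _ _ hk
      have hle := ncard_monochromatic_refinement_le hab hfab hca (by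
        intro z hz1 hz2 hzc
        rw [((hc z).1 ⟨hz1, hz2⟩).resolve_left hzc]
        exact hfcd.symm)
      have hcc := (hc c).2 (.inl rfl)
      have hf₁ := hf.refinement h hint (f c)
      have hadj : (edgeRefinement G a b).Adj none (some c) := .inr (.inr hcc)
      have hint₁ : IsInteriorEdge (edgeRefinement G a b) none (some c) :=
        ⟨hadj, fun hb => hf₁.adj _ _ hb.1 hb.2 hadj rfl⟩
      have h₁ := h.refinement hint
      have hlt := ncard_monochromatic_refinement_lt (k := f d)
        (f := fun o : Option V => o.elim (f c) f) hadj rfl hfcd.symm (by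
          rintro (_ | z) hz1 hz2
          · exact hz1.elim
          · rcases hz1 with rfl | rfl | hz
            · exact hda.symm
            · exact fun e => hda (e.symm.trans hfab.symm)
            · rcases (hc z).1 hz with rfl | rfl
              · exact absurd rfl hz2.1.ne
              · exact absurd hz2.1 hncd)
      obtain ⟨V', G', hG', hE⟩ := ih _ (hlt.trans_le hle) (h₁.refinement hint₁)
        (hf₁.refinement h₁ hint₁ (f d)) rfl
      exact ⟨V', G', .trans (.step _ _ (.step a b .refl hint) hint₁) hG', hE⟩

end

end DiscreteSurface

theorem mainTheorem2 {V : Type u} [Finite V] (G : SimpleGraph V)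
    (hG : DiscreteSurface.IsBall 2 G) :
    (∃ (W : Type u) (H : SimpleGraph W),
      DiscreteSurface.InteriorRefinement G H ∧ DiscreteSurface.IsEulerian H) ↔
      3 ∣ DiscreteSurface.boundaryLength G := by
  obtain ⟨W, H, x, ι, h⟩ := hG.exists_isCapping
  constructor
  · rintro ⟨V', G', hGG', hE⟩
    obtain ⟨hlen, _, _, _, _, h'⟩ := h.interiorRefinement hGG'
    exact hlen ▸ h'.three_dvd_boundaryLength hE
  · intro h3
    obtain ⟨f, hf⟩ := h.exists_isBoundaryColoring h3
    exact h.exists_isEulerian hf
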